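/- Let $X$ be a proper geodesic metric space with base point $\mathfrak o\in X$. A *sublinear function* is a nondecreasing $\rho:[0,\infty)\to[0,\infty)$ with $\rho(r)/r\to 0$ as $r\to\infty$. For closed $Z\subset X$ let $\pi_Z(x)=\{z\in Z: d(x,z)=d(x,Z)\}$; $Z$ is *$\rho$-contracting* if $d(x,y)\le d(x,Z)$ implies $\operatorname{diam}(\pi_Z(x)\cup\pi_Z(y))\le\rho(d(x,Z))$ for all $x,y\in X$, and *contracting* if it is $\rho$-contracting for some sublinear $\rho$. For $q\ge1$, $Q\ge0$, a *$(q,Q)$-quasi-geodesic ray* is a map $\alpha:[0,\infty)\to X$ with $\frac1q|s-t|-Q\le d(\alpha(s),\alpha(t))\le q|s-t|+Q$ for all $s,t$. The contracting boundary $\partial_cX$ is the set of quasi-geodesic rays $\alpha$ with $\alpha(0)=\mathfrak o$ whose image is (closed and) contracting, modulo the relation that the images are at finite Hausdorff distance. For sublinear $\rho$ put $$\kappa(\rho,q,Q)=\max\{3Q,\;3q^2,\;1+\inf\{R>0:\ 3q^2\rho(r)<r\ \text{for all } r\ge R\}\}.$$ For every $\mathbf b\in\partial_cX$ choose a geodesic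 ray $b\in\mathbf b$ (based at $\mathfrak o$) and a sublinear function $\rho_b$ such that $b$ is $\rho_b$-contracting. For $r>0$ let $U(\mathbf b,r)$ be the set of all $\mathbf a\in\partial_cX$ such that, for all $q\ge1$, $Q\ge0$ and every continuous $(q,Q)$-quasi-geodesic ray $\alpha\in\mathbf a$, $$d\bigl(\alpha,\ b\cap\{x: d(x,\mathfrak o)\ge r\}\bigr)\le\kappa(\rho_b,q,Q).$$ The Cashen–Mackay topology on $\partial_cX$ is the one in which $V\subset\partial_cX$ is open if and only if for every $\mathbf b\in V$ there is $r>0$ with $U(\mathbf b,r)\subset V$. **Corollary.** For every proper geodesic metric space $X$ and every base point $\mathfrak o$, such choices of $b$ and $\rho_b$ exist, and for every such choice $\partial_cX$ with the Cashen–Mackay topology is metrizable. -/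

import Mathlib

open scoped NNReal Topology

namespace ContractingBoundary

/-- A metric space is geodesic if any two points are joined by an isometrically embedded
interval. -/
def IsGeodesicSpace (X : Type*) [MetricSpace X] : Prop :=
  ∀ x y : X, ∃ γ : ℝ → X, γ 0 = x ∧ γ (dist x y) = y ∧
    ∀ s ∈ Set.Icc 0 (dist x y), ∀ t ∈ Set.Icc 0 (dist x y), dist (γ s) (γ t) = |s - t|

/-- `γ : [0,∞) → X` is a `(q, Q)`-quasi-geodesic ray (not necessarily continuous). -/
def IsQuasiGeodesicRay {X : Type*} [MetricSpace X] (q Q : ℝ) (γ : ℝ≥0 → X) : Prop :=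
  ∀ s t : ℝ≥0, dist s t / q - Q ≤ dist (γ s) (γ t) ∧ dist (γ s) (γ t) ≤ q * dist s t + Q

/-- A sublinear function: nonnegative, nondecreasing, and `ρ(r)/r → 0` as `r → ∞`. -/
def IsSublinear (ρ : ℝ≥0 → ℝ≥0) : Prop :=
  Monotone ρ ∧ Filter.Tendsto (fun r => ρ r / r) Filter.atTop (𝓝 0)

/-- The closest point projection of `x` to `Z`, as a subset of `Z`. -/
def proj {X : Type*} [MetricSpace X] (Z : Set X) (x : X) : Set X :=
  {z ∈ Z | dist x z = Metric.infDist x Z}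

/-- The closed set `Z` is `ρ`-contracting. -/
def IsContractingWith {X : Type*} [MetricSpace X] (ρ : ℝ≥0 → ℝ≥0) (Z : Set X) : Prop :=
  IsClosed Z ∧ ∀ x y : X, dist x y ≤ Metric.infDist x Z →
    Metric.diam (proj Z x ∪ proj Z y) ≤ ρ (Metric.infDist x Z).toNNReal

/-- The closed set `Z` is contracting. -/
def IsContracting {X : Type*} [MetricSpace X] (Z : Set X) : Prop :=
  ∃ ρ : ℝ≥0 → ℝ≥0, IsSublinear ρ ∧ IsContractingWith ρ Z

/-- Contracting quasi-geodesic rays based at `o`. -/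
structure ContractingRay {X : Type*} [MetricSpace X] (o : X) where
  /-- the underlying map -/
  toFun : ℝ≥0 → X
  map_zero : toFun 0 = o
  quasiGeodesic : ∃ q Q : ℝ, 1 ≤ q ∧ 0 ≤ Q ∧ IsQuasiGeodesicRay q Q toFun
  contracting : IsContracting (Set.range toFun)

/-- The image of a contracting ray. -/
def ContractingRay.image {X : Type*} [MetricSpace X] {o : X} (α : ContractingRay o) : Set X :=
  Set.range α.toFun

/-- Two contracting rays are equivalent if their images are a bounded Hausdorff distance apart. -/
instance raySetoid {X : Type*} [MetricSpace X] (o : X) : Setoid (ContractingRay o) where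
  r α β := Metric.hausdorffEDist α.image β.image ≠ ⊤
  iseqv :=
    { refl := fun α => by simp
      symm := fun {α β} h => by rwa [Metric.hausdorffEDist_comm]
      trans := fun {α β γ} h₁ h₂ =>
        ne_top_of_le_ne_top (ENNReal.add_ne_top.2 ⟨h₁, h₂⟩) Metric.hausdorffEDist_triangle }

/-- The contracting boundary of `X`, with base point `o`, as a set. -/
def Boundary {X : Type*} [MetricSpace X] (o : X) : Type _ :=
  Quotient (raySetoid o)

/-- The class in the contracting boundary of a contracting ray. -/
def ContractingRay.toBoundary {X : Type*} [MetricSpace X] {o : X} (α : ContractingRay o) :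
    Boundary o :=
  Quotient.mk (raySetoid o) α

/-- `κ(ρ, q, Q) = max {3Q, 3q², 1 + inf {R > 0 | ∀ r ≥ R, 3q² ρ(r) < r}}`. -/
noncomputable def kappa (ρ : ℝ≥0 → ℝ≥0) (q Q : ℝ) : ℝ :=
  max (max (3 * Q) (3 * q ^ 2))
    (1 + sInf {R : ℝ | 0 < R ∧ ∀ r : ℝ≥0, R ≤ r → 3 * q ^ 2 * (ρ r : ℝ) < r})

/-- The distance (infimum of pointwise distances) between two nonempty sets. -/
noncomputable def setDist {X : Type*} [MetricSpace X] (A B : Set X) : ℝ :=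
  sInf (Set.image2 dist A B)

/-- A choice, for each point `ζ` of the contracting boundary, of a geodesic ray `b` in the
class `ζ` and of a sublinear function `ρ` such that `b` is `ρ`-contracting. -/
structure RepSystem {X : Type*} [MetricSpace X] (o : X) where
  /-- the chosen geodesic ray in each class -/
  ray : Boundary o → ContractingRay o
  /-- the chosen contraction function of that ray -/
  gauge : Boundary o → ℝ≥0 → ℝ≥0
  isometry_ray : ∀ ζ, Isometry (ray ζ).toFun
  ray_mem : ∀ ζ, (ray ζ).toBoundary = ζ
  sublinear_gauge : ∀ ζ, IsSublinear (gauge ζ)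
  contracting_ray : ∀ ζ, IsContractingWith (gauge ζ) (ray ζ).image

namespace RepSystem

variable {X : Type*} [MetricSpace X] {o : X}

/-- The basic neighbourhood `U(ζ, r)`: all `η` such that every continuous `(q, Q)`-quasi-geodesic
ray in the class `η` passes within `κ(ρ, q, Q)` of the part of the chosen geodesic of `ζ` that lies
outside the open ball of radius `r` about `o`. -/
def nbhd (S : RepSystem o) (ζ : Boundary o) (r : ℝ) : Set (Boundary o) :=
  {η | ∀ q Q : ℝ, 1 ≤ q → 0 ≤ Q → ∀ α : ContractingRay o, α.toBoundary = η →
    Continuous α.toFun → IsQuasiGeodesicRay q Q α.toFun →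
      setDist α.image ((S.ray ζ).image ∩ (Metric.ball o r)ᶜ) ≤ kappa (S.gauge ζ) q Q}

theorem nbhd_anti (S : RepSystem o) (ζ : Boundary o) {r r' : ℝ} (h : r ≤ r') :
    S.nbhd ζ r' ⊆ S.nbhd ζ r := by
  intro η hη q Q hq hQ α hα hc hqg
  refine le_trans (csInf_le_csInf ⟨0, ?_⟩ ?_ (Set.image2_subset_left ?_)) (hη q Q hq hQ α hα hc hqg)
  · rintro _ ⟨a, -, b, -, rfl⟩
    exact dist_nonneg
  · refine Set.Nonempty.image2 (Set.range_nonempty _) ⟨_, ⟨r'.toNNReal, rfl⟩, ?_⟩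
    have h1 := (S.isometry_ray ζ).dist_eq r'.toNNReal 0
    rw [(S.ray ζ).map_zero] at h1
    simp only [Set.mem_compl_iff, Metric.mem_ball, not_lt, h1, NNReal.dist_eq]
    simpa using (le_max_left r' 0).trans (le_abs_self _)
  · exact Set.inter_subset_inter_right _ (Set.compl_subset_compl.2 (Metric.ball_subset_ball h))

/-- The Cashen–Mackay topology on the contracting boundary: a set `V` is open if and only if every
`ζ ∈ V` has some `U(ζ, r)` contained in `V`. -/
def topology (S : RepSystem o) : TopologicalSpace (Boundary o) where
  IsOpen V := ∀ ζ ∈ V, ∃ r : ℝ, 0 < r ∧ S.nbhd ζ r ⊆ V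
  isOpen_univ _ _ := ⟨1, one_pos, Set.subset_univ _⟩
  isOpen_inter := by
    intro V W hV hW ζ hζ
    obtain ⟨r, hr, h⟩ := hV ζ hζ.1
    obtain ⟨s, _, h'⟩ := hW ζ hζ.2
    exact ⟨max r s, lt_max_of_lt_left hr,
      Set.subset_inter ((S.nbhd_anti ζ (le_max_left r s)).trans h)
        ((S.nbhd_anti ζ (le_max_right r s)).trans h')⟩
  isOpen_sUnion := by
    intro 𝒱 h𝒱 ζ hζ
    obtain ⟨V, hV, hζV⟩ := hζ
    obtain ⟨r, hr, h⟩ := h𝒱 V hV ζ hζV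
    exact ⟨r, hr, h.trans (Set.subset_sUnion_of_mem hV)⟩

end RepSystem

end ContractingBoundary

/-! ### Frink-type metrization from a weak neighbourhood system. -/

namespace ContractingBoundary

open Filter Set

/-! Metrizability follows from Frink's criterion: for every `x` and `n` there is an `m` such that `V
y m` lies in `V x n` whenever it meets `V x m`. The squares of suitably re-indexed neighbourhoods
then form a countable base of a uniformity inducing the topology (`metrizableSpace_of_frink`).

The geometric engine is `length_le_of_kappa_le_infDist`. Outside the `κ`-neighbourhood of a
contracting set, the projection of a quasi-geodesic moves too slowly to account for its length, so
the length is controlled by the distances of its endpoints to the set. This has two consequences.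
One is the Morse property (`infDist_le_of_endpoints`). The other is that mere closeness with some
constant `C`, far enough out, improves to closeness with the exact constant `κ`
(`exists_infDist_le_kappa`, `exists_dist_le_kappa`). The Morse property applied to segments from
`o`, followed by a limit, yields geodesic representatives. They are contracting because contraction
survives finite Hausdorff distance.

For Frink's condition at `ζ`, let `ξ` be close to both `ζ` and `θ`, and let `η` be close to `θ`. A
quasi-geodesic `α` in `η` with moderate constants can be diverted, far out, into a quasi-geodesic
`β` in `ξ` with controlled constants (`exists_surgery`, `exists_diverted_ray`). Since `ξ` is close
to `ζ`, the ray `β` follows the chosen ray of `ζ`, hence so does the long initial part shared with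
`α` (`exists_dist_le_kappa_of_eqOn`). Large constants need no geometry: `κ` is then so large that
the base point already satisfies the required bound. The contraction functions are not uniform over
the boundary, so the radii in the neighbourhood system depend on the point. -/

/-- **Frink's metrization theorem**, for a topology generated by a weak neighbourhood system. -/
theorem metrizableSpace_of_frink {B : Type*} [τ : TopologicalSpace B] (V : B → ℕ → Set B)
    (anti : ∀ x, Antitone (V x)) (mem : ∀ x n, x ∈ V x n)
    (isOpen_iff : ∀ s : Set B, IsOpen s ↔ ∀ x ∈ s, ∃ n, V x n ⊆ s)
    (frink : ∀ x n, ∃ m, ∀ y, (V x m ∩ V y m).Nonempty → V y m ⊆ V x n)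
    (sep : ∀ x y, (∀ n, y ∈ V x n) → y = x) : TopologicalSpace.MetrizableSpace B := by
  choose m hm using frink
  -- The index depends on the point: `N (k + 1) x` is large enough for Frink's condition at `x` with
  -- target `N k x`, and the strict increase gives `k ≤ N k x`.
  let N : ℕ → B → ℕ := fun k => Nat.rec (fun _ => 0) (fun _ f x => max (m x (f x)) (f x + 1)) k
  have hNs : ∀ k x, N (k + 1) x = max (m x (N k x)) (N k x + 1) := fun _ _ => rfl
  have hNk : ∀ k x, k ≤ N k x := by
    intro k x
    induction k with
    | zero => exact Nat.zero_le _
    | succ k ih => rw [hNs]; omega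
  let W : ℕ → B → Set B := fun k x => V x (N k x)
  have hW : ∀ k x y, (W (k + 1) x ∩ W (k + 1) y).Nonempty →
      W (k + 1) x ∪ W (k + 1) y ⊆ W k x ∨ W (k + 1) x ∪ W (k + 1) y ⊆ W k y := by
    -- The point with the smaller index serves as the centre: both indices are then at least `m x (N
    -- k x)`, so the condition at `x` applies.
    have key : ∀ k x y, N (k + 1) x ≤ N (k + 1) y → (W (k + 1) x ∩ W (k + 1) y).Nonempty →
        W (k + 1) x ∪ W (k + 1) y ⊆ W k x := by
      intro k x y hle ⟨z, hzx, hzy⟩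
      have h1 : m x (N k x) ≤ N (k + 1) x := by rw [hNs]; exact le_max_left _ _
      have h2 : N k x ≤ N (k + 1) x := by rw [hNs]; omega
      refine union_subset (anti x h2) ((anti y (h1.trans hle)).trans (hm x _ y ⟨z, ?_, ?_⟩))
      · exact anti x h1 hzx
      · exact anti y (h1.trans hle) hzy
    intro k x y h
    rcases le_total (N (k + 1) x) (N (k + 1) y) with hle | hle
    · exact Or.inl (key k x y hle h)
    · rw [inter_comm] at h
      rw [union_comm]
      exact Or.inr (key k y x hle h)
  -- By `hW`, two overlapping squares of level `k + 1` lie in a single square of level `k`, which is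
  -- the composition axiom.
  let E : ℕ → Set (B × B) := fun k => {p | ∃ x, p.1 ∈ W k x ∧ p.2 ∈ W k x}
  have hEanti : Antitone E := by
    refine antitone_nat_of_succ_le fun k p hp => ?_
    obtain ⟨x, h1, h2⟩ := hp
    have : N k x ≤ N (k + 1) x := by rw [hNs]; omega
    exact ⟨x, anti x this h1, anti x this h2⟩
  have hbasis : (⨅ k, 𝓟 (E k)).HasBasis (fun _ : ℕ => True) E :=
    hasBasis_iInf_principal hEanti.directed_ge
  have hball : ∀ x n, ∃ k, ∀ y, (x, y) ∈ E k → y ∈ V x n := by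
    intro x n
    refine ⟨m x n, fun y hy => ?_⟩
    obtain ⟨z, h1, h2⟩ := hy
    have h1' := anti z (hNk _ z) h1
    exact hm x n z ⟨x, mem _ _, h1'⟩ (anti z (hNk _ z) h2)
  let core : UniformSpace.Core B :=
    { uniformity := ⨅ k, 𝓟 (E k)
      refl := by
        refine hbasis.ge_iff.2 fun k _ => ?_
        rintro ⟨x, y⟩ h
        obtain rfl : x = y := h
        exact ⟨x, mem _ _, mem _ _⟩
      symm := by
        refine (hbasis.tendsto_iff hbasis).2 fun k _ => ⟨k, trivial, ?_⟩
        rintro ⟨x, y⟩ ⟨z, h1, h2⟩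
        exact ⟨z, h2, h1⟩
      comp := by
        refine ((hbasis.lift' (monotone_id.relComp monotone_id)).le_basis_iff hbasis).2
          fun k _ => ⟨k + 1, trivial, ?_⟩
        rintro ⟨a, c⟩ ⟨b, ⟨x, h1, h2⟩, ⟨y, h3, h4⟩⟩
        rcases hW k x y ⟨b, h2, h3⟩ with h | h
        · exact ⟨x, h (Or.inl h1), h (Or.inr h4)⟩
        · exact ⟨y, h (Or.inl h1), h (Or.inr h4)⟩ }
  have htop : τ = core.toTopologicalSpace := by
    refine TopologicalSpace.ext_iff.2 fun s => ?_
    let u : UniformSpace B := UniformSpace.ofCore core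
    have hiff : IsOpen[core.toTopologicalSpace] s ↔
        ∀ x ∈ s, { p : B × B | p.1 = x → p.2 ∈ s } ∈ ⨅ k, 𝓟 (E k) := isOpen_uniformity
    rw [isOpen_iff, hiff]
    refine forall₂_congr fun x hx => ?_
    rw [hbasis.mem_iff]
    constructor
    · rintro ⟨n, hn⟩
      obtain ⟨k, hk⟩ := hball x n
      refine ⟨k, trivial, ?_⟩
      rintro ⟨a, y⟩ hp rfl
      exact hn (hk y hp)
    · rintro ⟨k, -, hk⟩
      exact ⟨N k x, fun y hy => hk (a := (x, y)) ⟨x, mem _ _, hy⟩ rfl⟩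
  let _ : UniformSpace B := UniformSpace.ofCoreEq core τ htop
  have : IsCountablyGenerated (uniformity B) :=
    HasCountableBasis.isCountablyGenerated ⟨hbasis, to_countable _⟩
  have : T0Space B := by
    refine ⟨fun x y hxy => (sep x y fun n => ?_).symm⟩
    obtain ⟨k, hk⟩ := hball x n
    refine hk y ?_
    exact (inseparable_iff_ker_uniformity.1 hxy) (E k) (hbasis.mem_of_mem trivial)
  exact UniformSpace.metrizableSpace

end ContractingBoundary

/-! ### Quasi-geodesics near a contracting set. -/

namespace ContractingBoundary

open Filter Set

section Kappa

variable {ρ : ℝ≥0 → ℝ≥0}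

theorem IsSublinear.eventually_mul_lt (hρ : IsSublinear ρ) {c : ℝ} (hc : 0 < c) :
    ∃ R : ℝ, 0 < R ∧ ∀ r : ℝ≥0, R ≤ r → c * (ρ r : ℝ) < r := by
  have h1 : ∀ᶠ r in atTop, ρ r / r < (c⁻¹).toNNReal :=
    hρ.2.eventually_lt_const (by simpa using hc)
  obtain ⟨R, hR⟩ := eventually_atTop.1 h1
  refine ⟨R + 1, by positivity, fun r hr => ?_⟩
  have hRr : R ≤ r := by
    have : (R : ℝ) ≤ r := by linarith
    exact_mod_cast this
  have hr0 : 0 < (r : ℝ) := by have := R.2; linarith [NNReal.coe_nonneg R]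
  have h2 := hR r hRr
  rw [← NNReal.coe_lt_coe, NNReal.coe_div, Real.coe_toNNReal _ (by positivity), div_lt_iff₀ hr0,
    inv_mul_eq_div, lt_div_iff₀ hc] at h2
  linarith

/-- The summand `1` in `kappa` puts the infimum strictly below `r`, so some admissible `R` is below
`r` and the infimum need not be attained. -/
theorem mul_sq_lt_of_kappa_le (hρ : IsSublinear ρ) {q Q : ℝ} (hq : 1 ≤ q) {r : ℝ≥0}
    (hr : kappa ρ q Q ≤ r) : 3 * q ^ 2 * (ρ r : ℝ) < r := by
  obtain ⟨R₀, hR₀⟩ := hρ.eventually_mul_lt (c := 3 * q ^ 2) (by positivity)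
  have h1 : sInf {R : ℝ | 0 < R ∧ ∀ r : ℝ≥0, R ≤ r → 3 * q ^ 2 * (ρ r : ℝ) < r} < r := by
    have := (le_max_right _ _).trans hr
    linarith
  obtain ⟨R, hR, hRr⟩ := exists_lt_of_csInf_lt ⟨R₀, hR₀⟩ h1
  exact hR.2 r hRr.le

theorem three_mul_le_kappa (ρ : ℝ≥0 → ℝ≥0) (q Q : ℝ) : 3 * Q ≤ kappa ρ q Q :=
  (le_max_left _ _).trans (le_max_left _ _)

theorem three_mul_sq_le_kappa (ρ : ℝ≥0 → ℝ≥0) (q Q : ℝ) : 3 * q ^ 2 ≤ kappa ρ q Q :=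
  (le_max_right _ _).trans (le_max_left _ _)

theorem three_le_kappa (ρ : ℝ≥0 → ℝ≥0) {q : ℝ} (hq : 1 ≤ q) (Q : ℝ) : 3 ≤ kappa ρ q Q := by
  have := three_mul_sq_le_kappa ρ q Q
  nlinarith

theorem kappa_mono (hρ : IsSublinear ρ) {q q' Q Q' : ℝ} (hq : 1 ≤ q) (hqq : q ≤ q')
    (hQ : Q ≤ Q') : kappa ρ q Q ≤ kappa ρ q' Q' := by
  have hsq : q ^ 2 ≤ q' ^ 2 := by gcongr
  refine max_le_max (max_le_max (by linarith) (by linarith)) ?_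
  obtain ⟨R₀, hR₀⟩ := hρ.eventually_mul_lt (c := 3 * q' ^ 2) (by nlinarith)
  refine add_le_add le_rfl (csInf_le_csInf ⟨0, fun R hR => hR.1.le⟩ ⟨R₀, hR₀⟩ fun R hR =>
    ⟨hR.1, fun r hr => lt_of_le_of_lt ?_ (hR.2 r hr)⟩)
  gcongr

end Kappa

variable {X : Type*} [MetricSpace X]

section Proj

theorem exists_mem_proj [ProperSpace X] {Z : Set X} (hZ : IsClosed Z) (hne : Z.Nonempty) (x : X) :
    ∃ p, p ∈ proj Z x := by
  obtain ⟨p, hp, h⟩ := hZ.exists_infDist_eq_dist hne x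
  exact ⟨p, hp, h.symm⟩

theorem isBounded_proj (Z : Set X) (x : X) : Bornology.IsBounded (proj Z x) :=
  (Metric.isBounded_closedBall (x := x) (r := Metric.infDist x Z)).subset fun z hz => by
    rw [Metric.mem_closedBall, dist_comm]
    exact hz.2.le

theorem dist_proj_le {ρ : ℝ≥0 → ℝ≥0} {Z : Set X} (hZ : IsContractingWith ρ Z) {x y p p' : X}
    (hxy : dist x y ≤ Metric.infDist x Z) (hp : p ∈ proj Z x) (hp' : p' ∈ proj Z y) :
    dist p p' ≤ ρ (Metric.infDist x Z).toNNReal :=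
  (Metric.dist_le_diam_of_mem ((isBounded_proj Z x).union (isBounded_proj Z y)) (Or.inl hp)
    (Or.inr hp')).trans (hZ.2 x y hxy)

end Proj

/-- `α` is a `(q, Q)`-quasi-geodesic on the interval `[a, b]`. -/
def IsQuasiGeodesicOn (q Q : ℝ) (α : ℝ → X) (a b : ℝ) : Prop :=
  ∀ s ∈ Icc a b, ∀ t ∈ Icc a b,
    |s - t| / q - Q ≤ dist (α s) (α t) ∧ dist (α s) (α t) ≤ q * |s - t| + Q

theorem IsQuasiGeodesicOn.mono {q Q : ℝ} {α : ℝ → X} {a b a' b' : ℝ}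
    (h : IsQuasiGeodesicOn q Q α a b) (ha : a ≤ a') (hb : b' ≤ b) :
    IsQuasiGeodesicOn q Q α a' b' :=
  fun s hs t ht => h s (Icc_subset_Icc ha hb hs) t (Icc_subset_Icc ha hb ht)

theorem exists_last_eq {f : ℝ → ℝ} {a b c : ℝ} (hab : a ≤ b) (hf : ContinuousOn f (Icc a b))
    (ha : f a ≤ c) (hb : c ≤ f b) : ∃ u ∈ Icc a b, f u = c ∧ ∀ v ∈ Icc u b, c ≤ f v := by
  have hcl : IsClosed {u ∈ Icc a b | f u ≤ c} := by
    have := hf.preimage_isClosed_of_isClosed isClosed_Icc (isClosed_Iic (a := c))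
    exact this
  have hcomp : IsCompact {u ∈ Icc a b | f u ≤ c} :=
    isCompact_Icc.of_isClosed_subset hcl (fun u hu => hu.1)
  obtain ⟨u, ⟨hu, huc⟩, hmax⟩ := hcomp.exists_isGreatest ⟨a, ⟨le_rfl, hab⟩, ha⟩
  have hfu : f u = c := by
    obtain ⟨v, hv, hvc⟩ := intermediate_value_Icc hu.2
      (hf.mono (Icc_subset_Icc_left hu.1)) ⟨huc, hb⟩
    have h1 : v ≤ u := hmax ⟨⟨hu.1.trans hv.1, hv.2⟩, hvc.le⟩
    rw [le_antisymm h1 hv.1] at hvc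
    exact hvc
  refine ⟨u, hu, hfu, fun v hv => ?_⟩
  by_contra! hlt
  have h1 : v ≤ u := hmax ⟨⟨hu.1.trans hv.1, hv.2⟩, hlt.le⟩
  rw [le_antisymm h1 hv.1, hfu] at hlt
  exact lt_irrefl _ hlt

theorem exists_first_eq {f : ℝ → ℝ} {a b c : ℝ} (hab : a ≤ b) (hf : ContinuousOn f (Icc a b))
    (ha : c ≤ f a) (hb : f b ≤ c) : ∃ u ∈ Icc a b, f u = c ∧ ∀ v ∈ Icc a u, c ≤ f v := by
  have hf' : ContinuousOn (fun u => f (-u)) (Icc (-b) (-a)) :=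
    hf.comp continuous_neg.continuousOn fun u hu => ⟨by linarith [hu.2], by linarith [hu.1]⟩
  obtain ⟨u, hu, huc, h⟩ := exists_last_eq (c := c) (neg_le_neg hab) hf' (by simpa using hb)
    (by simpa using ha)
  refine ⟨-u, ⟨by linarith [hu.2], by linarith [hu.1]⟩, huc, fun v hv => ?_⟩
  simpa using h (-v) ⟨by linarith [hv.2], by linarith [hv.1]⟩

section Contraction

variable [ProperSpace X] {ρ : ℝ≥0 → ℝ≥0} {Z : Set X} {q Q a b : ℝ} {α : ℝ → X}

/-- A quasi-geodesic that stays outside the `κ`-neighbourhood of a contracting set is short relative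
to the distances of its endpoints to that set. -/
theorem length_le_of_kappa_le_infDist (hρ : IsSublinear ρ) (hZ : IsContractingWith ρ Z)
    (hne : Z.Nonempty) (hq : 1 ≤ q) (hQ : 0 ≤ Q) (hα : IsQuasiGeodesicOn q Q α a b)
    (hc : ContinuousOn α (Icc a b)) (hab : a ≤ b)
    (hfar : ∀ t ∈ Icc a b, kappa ρ q Q ≤ Metric.infDist (α t) Z) :
    b - a ≤ 8 * q * (Metric.infDist (α a) Z + Metric.infDist (α b) Z + Q) := by
  have hq0 : 0 < q := by linarith
  have hρ_lt : ∀ t ∈ Icc a b, (ρ (Metric.infDist (α t) Z).toNNReal : ℝ) ≤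
      Metric.infDist (α t) Z / (3 * q ^ 2) := by
    intro t ht
    have h1 := mul_sq_lt_of_kappa_le (r := (Metric.infDist (α t) Z).toNNReal) hρ hq
      (by rw [Real.coe_toNNReal _ Metric.infDist_nonneg]; exact hfar t ht)
    rw [Real.coe_toNNReal _ Metric.infDist_nonneg] at h1
    rw [le_div_iff₀ (by positivity)]
    linarith
  obtain ⟨p, hp⟩ := exists_mem_proj hZ.1 hne (α a)
  -- `P t` says that up to time `t` the projection has drifted at speed at most `1 / (2q)`, half the
  -- lower speed of the quasi-geodesic.
  let P : ℝ → Prop := fun t => t ∈ Icc a b ∧ ∃ p' ∈ proj Z (α t), dist p p' ≤ (t - a) / (2 * q)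
  have hstep : ∀ t, P t → (∃ t', t + 2 / q ≤ t' ∧ P t') ∨
      ∀ u ∈ Icc t b, dist (α t) (α u) ≤ Metric.infDist (α t) Z := by
    rintro t ⟨ht, p', hp', hd⟩
    by_cases hex : ∀ u ∈ Icc t b, dist (α t) (α u) ≤ Metric.infDist (α t) Z
    · exact Or.inr hex
    push Not at hex
    obtain ⟨u, hu, hlt⟩ := hex
    have hc' : ContinuousOn (fun v => dist (α t) (α v)) (Icc t u) :=
      (continuous_const.dist continuous_id).comp_continuousOn
        (hc.mono (Icc_subset_Icc ht.1 hu.2))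
    obtain ⟨v, hv, hvd⟩ := intermediate_value_Icc hu.1 hc'
      ⟨by simpa using Metric.infDist_nonneg, hlt.le⟩
    have hvb : v ∈ Icc a b := ⟨ht.1.trans hv.1, hv.2.trans hu.2⟩
    obtain ⟨p'', hp''⟩ := exists_mem_proj hZ.1 hne (α v)
    have h1 := (hα t ht v hvb).2
    have h2 := dist_proj_le hZ hvd.le hp' hp''
    have h3 := hρ_lt t ht
    have h4 := hfar t ht
    have h5 := three_mul_le_kappa ρ q Q
    have h6 := three_le_kappa ρ hq Q
    rw [abs_sub_comm, abs_of_nonneg (sub_nonneg.2 hv.1)] at h1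
    simp only at hvd
    rw [hvd] at h1
    -- Here `Q ≤ κ / 3`, so `Q` is at most a third of the distance to `Z`. That distance is at least
    -- `3`, so each step takes time at least `2 / q` and the process stops.
    have h7 : Metric.infDist (α t) Z * (2 / 3) ≤ q * (v - t) := by linarith
    refine Or.inl ⟨v, ?_, hvb, p'', hp'', ?_⟩
    · have : 2 / q ≤ v - t := by
        rw [div_le_iff₀ hq0]
        nlinarith
      linarith
    · have h8 : Metric.infDist (α t) Z / (3 * q ^ 2) ≤ (v - t) / (2 * q) := by
        rw [div_le_div_iff₀ (by positivity) (by positivity)]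
        have := mul_le_mul_of_nonneg_right h7 hq0.le
        nlinarith
      have h9 : (v - a) / (2 * q) = (t - a) / (2 * q) + (v - t) / (2 * q) := by ring
      linarith [dist_triangle p p' p'']
  obtain ⟨t, ⟨ht, p', hp', hd⟩, hlast⟩ : ∃ t, P t ∧
      ∀ u ∈ Icc t b, dist (α t) (α u) ≤ Metric.infDist (α t) Z := by
    by_contra! hcon
    have hind : ∀ n : ℕ, ∃ t, a + n * (2 / q) ≤ t ∧ P t := by
      intro n
      induction n with
      | zero => exact ⟨a, by simp, ⟨le_rfl, hab⟩, p, hp, by simp⟩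
      | succ n ih =>
        obtain ⟨t, htn, hPt⟩ := ih
        rcases hstep t hPt with ⟨t', h1, h2⟩ | h
        · exact ⟨t', by push_cast; linarith, h2⟩
        · obtain ⟨u, hu, hlt⟩ := hcon t hPt
          exact absurd (h u hu) (not_le.2 hlt)
    obtain ⟨n, hn⟩ := exists_nat_gt ((b - a) / (2 / q))
    rw [div_lt_iff₀ (by positivity)] at hn
    obtain ⟨t, h1, h2, -⟩ := hind n
    linarith [h2.2]
  obtain ⟨p'', hp''⟩ := exists_mem_proj hZ.1 hne (α b)
  have haab : a ∈ Icc a b := ⟨le_rfl, hab⟩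
  have hbab : b ∈ Icc a b := ⟨hab, le_rfl⟩
  have h1 := dist_proj_le hZ (hlast b ⟨ht.2, le_rfl⟩) hp' hp''
  have h2 := hρ_lt t ht
  have h3 : Metric.infDist (α t) Z ≤ Metric.infDist (α a) Z + (q * (b - a) + Q) := by
    have h4 := (hα t ht a haab).2
    rw [abs_of_nonneg (sub_nonneg.2 ht.1)] at h4
    have h5 : Metric.infDist (α t) Z ≤ Metric.infDist (α a) Z + dist (α t) (α a) :=
      Metric.infDist_le_infDist_add_dist
    have h6 : q * (t - a) ≤ q * (b - a) := by gcongr; exact ht.2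
    linarith
  have h4 := (hα a haab b hbab).1
  rw [abs_sub_comm, abs_of_nonneg (sub_nonneg.2 hab)] at h4
  have h5 : dist (α a) (α b) ≤ Metric.infDist (α a) Z + (t - a) / (2 * q)
      + Metric.infDist (α t) Z / (3 * q ^ 2) + Metric.infDist (α b) Z := by
    have e1 := hp.2
    have e2 := hp''.2
    have e3 := dist_triangle4 (α a) p p'' (α b)
    have e4 := dist_triangle p p' p''
    rw [dist_comm p''] at e3
    linarith
  have h6 : (t - a) / (2 * q) ≤ (b - a) / (2 * q) := by gcongr; exact ht.2
  have h7 : Metric.infDist (α t) Z / (3 * q ^ 2) ≤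
      (Metric.infDist (α a) Z + Q) / 3 + (b - a) / (3 * q) := by
    have e1 : (Metric.infDist (α a) Z + Q) / 3 + (b - a) / (3 * q) =
      ((Metric.infDist (α a) Z + Q) * q ^ 2 + q * (b - a)) / (3 * q ^ 2) := by
      field_simp
    rw [e1]
    gcongr
    have e2 : 0 ≤ Metric.infDist (α a) Z + Q := add_nonneg Metric.infDist_nonneg hQ
    nlinarith [mul_nonneg e2 (by nlinarith : 0 ≤ q ^ 2 - 1)]
  -- The two drift terms use up `1/2 + 1/3` of the lower bound `(b - a) / q`; the remaining sixth
  -- yields the estimate.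
  have h8 : (b - a) / q - (b - a) / (2 * q) - (b - a) / (3 * q) = (b - a) / (6 * q) := by
    field_simp
    ring
  have h9 : (b - a) / (6 * q) ≤
      4 / 3 * (Metric.infDist (α a) Z + Metric.infDist (α b) Z + Q) := by
    have : 0 ≤ Metric.infDist (α b) Z := Metric.infDist_nonneg
    linarith
  rw [div_le_iff₀ (by positivity)] at h9
  linarith

/-- The Morse property: a quasi-geodesic with endpoints close to a contracting set stays close. -/
theorem infDist_le_of_endpoints (hρ : IsSublinear ρ) (hZ : IsContractingWith ρ Z)
    (hne : Z.Nonempty) (hq : 1 ≤ q) (hQ : 0 ≤ Q) (hα : IsQuasiGeodesicOn q Q α a b)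
    (hc : ContinuousOn α (Icc a b)) {C : ℝ} (hC : kappa ρ q Q ≤ C)
    (ha : Metric.infDist (α a) Z ≤ C) (hb : Metric.infDist (α b) Z ≤ C) {t : ℝ}
    (ht : t ∈ Icc a b) : Metric.infDist (α t) Z ≤ C + 8 * q ^ 2 * (2 * C + Q) + Q := by
  have hC0 : 0 ≤ C := Metric.infDist_nonneg.trans ha
  rcases le_total (Metric.infDist (α t) Z) C with h | h
  · have : 0 ≤ 8 * q ^ 2 * (2 * C + Q) := by positivity
    linarith
  have hf : ContinuousOn (fun u => Metric.infDist (α u) Z) (Icc a b) :=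
    (Metric.continuous_infDist_pt Z).comp_continuousOn hc
  -- The excursion around `t` outside the `C`-neighbourhood starts and ends at distance exactly `C`,
  -- so its length is bounded.
  obtain ⟨u, hu, huC, hu'⟩ := exists_last_eq ht.1 (hf.mono (Icc_subset_Icc_right ht.2)) ha h
  obtain ⟨v, hv, hvC, hv'⟩ := exists_first_eq ht.2 (hf.mono (Icc_subset_Icc_left ht.1)) h hb
  have hlen := length_le_of_kappa_le_infDist hρ hZ hne hq hQ (hα.mono hu.1 hv.2)
    (hc.mono (Icc_subset_Icc hu.1 hv.2)) (hu.2.trans hv.1) (fun w hw => by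
      rcases le_total w t with hwt | hwt
      · exact hC.trans (hu' w ⟨hw.1, hwt⟩)
      · exact hC.trans (hv' w ⟨hwt, hw.2⟩))
  rw [huC, hvC] at hlen
  have h1 := (hα t ht u ⟨hu.1, hu.2.trans ht.2⟩).2
  rw [abs_of_nonneg (sub_nonneg.2 hu.2)] at h1
  have h2 : Metric.infDist (α t) Z ≤ Metric.infDist (α u) Z + dist (α t) (α u) :=
    Metric.infDist_le_infDist_add_dist
  have h3 : q * (t - u) ≤ q * (8 * q * (C + C + Q)) := by
    gcongr
    linarith [hv.1]
  rw [huC] at h2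
  linarith

/-- A quasi-geodesic that starts near a contracting set and ends at distance at most `C` from it
enters the `κ`-neighbourhood at bounded distance from its end. -/
theorem exists_infDist_le_kappa (hρ : IsSublinear ρ) (hZ : IsContractingWith ρ Z)
    (hne : Z.Nonempty) (hq : 1 ≤ q) (hQ : 0 ≤ Q) (hα : IsQuasiGeodesicOn q Q α a b)
    (hc : ContinuousOn α (Icc a b)) (hab : a ≤ b) {C : ℝ}
    (ha : Metric.infDist (α a) Z ≤ kappa ρ q Q) (hb : Metric.infDist (α b) Z ≤ C) :
    ∃ t ∈ Icc a b, Metric.infDist (α t) Z ≤ kappa ρ q Q ∧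
      dist (α t) (α b) ≤ 8 * q ^ 2 * (kappa ρ q Q + C + Q) + Q := by
  have hC0 : 0 ≤ C := Metric.infDist_nonneg.trans hb
  have hk0 : 0 ≤ kappa ρ q Q := Metric.infDist_nonneg.trans ha
  rcases le_total (Metric.infDist (α b) Z) (kappa ρ q Q) with h | h
  · exact ⟨b, ⟨hab, le_rfl⟩, h, by rw [dist_self]; positivity⟩
  have hf : ContinuousOn (fun u => Metric.infDist (α u) Z) (Icc a b) :=
    (Metric.continuous_infDist_pt Z).comp_continuousOn hc
  obtain ⟨u, hu, huC, hu'⟩ := exists_last_eq hab hf ha h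
  have hlen := length_le_of_kappa_le_infDist hρ hZ hne hq hQ (hα.mono hu.1 le_rfl)
    (hc.mono (Icc_subset_Icc hu.1 le_rfl)) hu.2 hu'
  rw [huC] at hlen
  refine ⟨u, hu, huC.le, ?_⟩
  have h1 := (hα u hu b ⟨hab, le_rfl⟩).2
  rw [abs_sub_comm, abs_of_nonneg (sub_nonneg.2 hu.2)] at h1
  have h3 : q * (b - u) ≤ q * (8 * q * (kappa ρ q Q + C + Q)) := by
    gcongr
    exact hlen.trans (by gcongr)
  linarith

end Contraction

end ContractingBoundary

/-! ### Hausdorff invariance of contraction and geodesic representatives. -/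

namespace ContractingBoundary

open Filter Set

variable {X : Type*} [MetricSpace X]

section Coarse

theorem hausdorffEDist_ne_top_iff {A B : Set X} : Metric.hausdorffEDist A B ≠ ⊤ ↔
    ∃ C : ℝ≥0, (∀ x ∈ A, ∃ y ∈ B, dist x y ≤ C) ∧ ∀ x ∈ B, ∃ y ∈ A, dist x y ≤ C := by
  constructor
  · intro h
    have key : ∀ A B : Set X, Metric.hausdorffEDist A B ≠ ⊤ →
        ∀ x ∈ A, ∃ y ∈ B, dist x y ≤ ((Metric.hausdorffEDist A B).toNNReal + 1 : ℝ≥0) := by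
      intro A B h x hx
      obtain ⟨y, hy, hxy⟩ := Metric.exists_edist_lt_of_hausdorffEDist_lt
        (r := ((Metric.hausdorffEDist A B).toNNReal + 1 : ℝ≥0)) hx (by
          conv_lhs => rw [← ENNReal.coe_toNNReal h]
          exact_mod_cast lt_add_one _)
      exact ⟨y, hy, NNReal.coe_le_coe.2 (edist_le_coe.1 hxy.le)⟩
    refine ⟨_, key A B h, ?_⟩
    have := key B A (by rwa [Metric.hausdorffEDist_comm])
    rwa [Metric.hausdorffEDist_comm] at this
  · rintro ⟨C, h1, h2⟩
    refine ne_top_of_le_ne_top (ENNReal.coe_ne_top (r := C)) ?_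
    refine Metric.hausdorffEDist_le_of_mem_edist (fun x hx => ?_) fun x hx => ?_
    · obtain ⟨y, hy, h⟩ := h1 x hx
      exact ⟨y, hy, edist_le_coe.2 h⟩
    · obtain ⟨y, hy, h⟩ := h2 x hx
      exact ⟨y, hy, edist_le_coe.2 h⟩

variable [ProperSpace X] {ρ : ℝ≥0 → ℝ≥0} {Z Z' : Set X}

/-- The geodesic from `x` to `y` is cut where it leaves the ball of radius `infDist x Z`, and
contraction is applied to each piece. If the cut point is closer than `C` to `Z`, the second piece
and its projections are short anyway, contributing at most `4C`. -/
theorem dist_proj_le_of_dist_le_add (hX : IsGeodesicSpace X) (hρ : Monotone ρ)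
    (hZ : IsContractingWith ρ Z) (hne : Z.Nonempty) {C N : ℝ≥0} {x y p p' : X}
    (hxy : dist x y ≤ Metric.infDist x Z + C) (hN : 2 * Metric.infDist x Z + C ≤ N)
    (hp : p ∈ proj Z x) (hp' : p' ∈ proj Z y) : dist p p' ≤ 2 * ρ N + 4 * C := by
  have hD : 0 ≤ Metric.infDist x Z := Metric.infDist_nonneg
  have hC := C.2
  have hle : ∀ r : ℝ, r ≤ N → (ρ r.toNNReal : ℝ) ≤ ρ N := fun r hr =>
    NNReal.coe_le_coe.2 (hρ (Real.toNNReal_le_iff_le_coe.2 hr))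
  have hρN : (0 : ℝ) ≤ ρ N := (ρ N).2
  simp only [NNReal.val_eq_coe] at hC
  rcases le_or_gt (dist x y) (Metric.infDist x Z) with h | h
  · have := (dist_proj_le hZ h hp hp').trans (hle _ (by linarith))
    linarith
  · obtain ⟨γ, h0, h1, hγ⟩ := hX x y
    have m0 : (0 : ℝ) ∈ Icc 0 (dist x y) := ⟨le_rfl, dist_nonneg⟩
    have m1 : dist x y ∈ Icc 0 (dist x y) := ⟨dist_nonneg, le_rfl⟩
    have mD : Metric.infDist x Z ∈ Icc 0 (dist x y) := ⟨hD, h.le⟩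
    have e1 := hγ _ m0 _ mD
    have e2 := hγ _ mD _ m1
    rw [h0, zero_sub, abs_neg, abs_of_nonneg hD] at e1
    rw [h1, abs_sub_comm, abs_of_nonneg (by linarith)] at e2
    generalize γ (Metric.infDist x Z) = u at e1 e2
    obtain ⟨pu, hpu⟩ := exists_mem_proj hZ.1 hne u
    have e3 := (dist_proj_le hZ e1.le hp hpu).trans (hle _ (by linarith))
    have e4 : Metric.infDist u Z ≤ Metric.infDist x Z + dist u x :=
      Metric.infDist_le_infDist_add_dist
    rw [dist_comm u x] at e4
    have e5 := dist_triangle p pu p'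
    rcases le_or_gt (C : ℝ) (Metric.infDist u Z) with hu | hu
    · have := (dist_proj_le hZ (by linarith) hpu hp').trans (hle _ (by linarith))
      linarith
    · have e6 : Metric.infDist y Z ≤ Metric.infDist u Z + dist y u :=
        Metric.infDist_le_infDist_add_dist
      have e7 := dist_triangle4 pu u y p'
      rw [dist_comm pu u, hpu.2, hp'.2] at e7
      rw [dist_comm y u] at e6
      linarith

theorem IsSublinear.affine (hρ : IsSublinear ρ) (C : ℝ≥0) :
    IsSublinear fun r => 8 * ρ (4 * r + 3 * C) + 18 * C := by
  refine ⟨fun r s h => ?_, ?_⟩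
  · have : ρ (4 * r + 3 * C) ≤ ρ (4 * s + 3 * C) := hρ.1 (by gcongr)
    show 8 * ρ (4 * r + 3 * C) + 18 * C ≤ 8 * ρ (4 * s + 3 * C) + 18 * C
    gcongr
  · have hN : Tendsto (fun r : ℝ≥0 => 4 * r + 3 * C) atTop atTop :=
      tendsto_atTop_mono (fun r => by
        calc r = 1 * r + 0 := by ring
          _ ≤ 4 * r + 3 * C := by gcongr <;> norm_num) tendsto_id
    have h1 := (hρ.2.comp hN).const_mul (8 * (4 + 3 * C))
    have h2 : Tendsto (fun r : ℝ≥0 => 18 * C / r) atTop (𝓝 0) := by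
      rw [← NNReal.tendsto_coe]
      push_cast
      exact tendsto_const_nhds.div_atTop (NNReal.tendsto_coe_atTop.2 tendsto_id)
    have h3 := h1.add h2
    simp only [mul_zero, add_zero] at h3
    refine tendsto_of_tendsto_of_tendsto_of_le_of_le' tendsto_const_nhds h3
      (Eventually.of_forall fun _ => zero_le) ?_
    filter_upwards [eventually_ge_atTop 1] with r hr
    have hr0 : 0 < r := lt_of_lt_of_le one_pos hr
    have hN0 : 0 < 4 * r + 3 * C := by positivity
    rw [add_div]
    gcongr
    simp only [Function.comp]
    rw [div_le_iff₀ hr0]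
    calc 8 * ρ (4 * r + 3 * C)
        = 8 * (4 * r + 3 * C) * (ρ (4 * r + 3 * C) / (4 * r + 3 * C)) := by field_simp
      _ ≤ 8 * (4 * r + 3 * C * r) * (ρ (4 * r + 3 * C) / (4 * r + 3 * C)) := by
        have : 3 * C ≤ 3 * C * r := le_mul_of_one_le_right zero_le hr
        exact mul_le_mul_left (mul_le_mul_right (add_le_add_right this _) _) _
      _ = _ := by ring

/-- In a geodesic space, being contracting is invariant under finite Hausdorff distance. -/
theorem IsContracting.of_hausdorffEDist_ne_top (hX : IsGeodesicSpace X) (hZ : IsContracting Z)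
    (hZ' : IsClosed Z') (hne : Z.Nonempty) (h : Metric.hausdorffEDist Z Z' ≠ ⊤) :
    IsContracting Z' := by
  obtain ⟨ρ, hρ, hZ⟩ := hZ
  obtain ⟨C, hC, hC'⟩ := hausdorffEDist_ne_top_iff.1 h
  refine ⟨_, hρ.affine C, hZ', fun x y hxy => ?_⟩
  have hne' : Z'.Nonempty := by
    obtain ⟨z, hz⟩ := hne
    obtain ⟨y, hy, -⟩ := hC z hz
    exact ⟨y, hy⟩
  have hle : ∀ A B : Set X, A.Nonempty → (∀ x ∈ A, ∃ y ∈ B, dist x y ≤ C) → ∀ x,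
      IsClosed A → Metric.infDist x B ≤ Metric.infDist x A + C := by
    intro A B hA hAB x hcl
    obtain ⟨a, ha, hxa⟩ := exists_mem_proj hcl hA x
    obtain ⟨b, hb, hab⟩ := hAB a ha
    have h1 := Metric.infDist_le_dist_of_mem (x := x) hb
    linarith [dist_triangle x a b]
  have h1 := hle Z Z' hne hC
  have h2 := hle Z' Z hne' hC'
  set r := (Metric.infDist x Z').toNNReal with hr
  have hrx : Metric.infDist x Z' = r := (Real.coe_toNNReal _ Metric.infDist_nonneg).symm
  -- Both projection arguments fit under `N`; the worse one is at `y`, where `infDist y Z ≤ 2 * r +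
  -- C`.
  set N : ℝ≥0 := 4 * r + 3 * C with hN
  have hNc : (N : ℝ) = 4 * r + 3 * C := by rw [hN]; push_cast; ring
  have hr0 : (0 : ℝ) ≤ r := r.2
  have hC0 : (0 : ℝ) ≤ C := C.2
  have hρ0 : (0 : ℝ) ≤ ρ N := (ρ N).2
  have key : ∀ v : X, 2 * Metric.infDist v Z + C ≤ N → ∀ p ∈ proj Z v, ∀ w ∈ proj Z' v,
      dist p w ≤ 2 * ρ N + 5 * C := by
    intro v hv p hp w hw
    obtain ⟨pw, hpw⟩ := exists_mem_proj hZ.1 hne w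
    have e1 : dist v w ≤ Metric.infDist v Z + C := hw.2.trans_le (h1 v hZ.1)
    have e2 := dist_proj_le_of_dist_le_add hX hρ.1 hZ hne e1 hv hp hpw
    have e3 : dist w pw ≤ C := by
      have := h2 w hZ'
      rw [Metric.infDist_zero_of_mem hw.1, zero_add] at this
      exact hpw.2.trans_le this
    linarith [dist_triangle p pw w, dist_comm w pw]
  have hx := h2 x hZ'
  have hx1 := h1 x hZ.1
  have hy : Metric.infDist y Z ≤ Metric.infDist x Z + dist y x :=
    Metric.infDist_le_infDist_add_dist
  rw [dist_comm] at hy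
  obtain ⟨p, hp⟩ := exists_mem_proj hZ.1 hne x
  obtain ⟨py, hpy⟩ := exists_mem_proj hZ.1 hne y
  have hxN : 2 * Metric.infDist x Z + C ≤ N := by linarith
  have hppy := dist_proj_le_of_dist_le_add hX hρ.1 hZ hne (by linarith) hxN hp hpy
  have hball : ∀ w ∈ proj Z' x ∪ proj Z' y, dist p w ≤ 4 * ρ N + 9 * C := by
    rintro w (hw | hw)
    · have := key x hxN p hp w hw
      linarith
    · have := key y (by linarith) py hpy w hw
      linarith [dist_triangle p py w]
  push_cast
  refine Metric.diam_le_of_forall_dist_le (by positivity) fun v hv w hw => ?_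
  linarith [hball v hv, hball w hw, dist_triangle_left v w p]

end Coarse

/-- A closed set lying, far out, along geodesic segments from `o` is followed by a geodesic ray. -/
theorem exists_isometry_of_segments [ProperSpace X] {Z : Set X} {o : X} {M : ℝ} (ℓ : ℕ → ℝ)
    (hℓ : Tendsto ℓ atTop atTop) (g : ℕ → ℝ → X) (h0 : ∀ n, g n 0 = o)
    (hg : ∀ n, ∀ s ∈ Icc 0 (ℓ n), ∀ t ∈ Icc 0 (ℓ n), dist (g n s) (g n t) = |s - t|)
    (hM : ∀ n, ∀ t ∈ Icc 0 (ℓ n), Metric.infDist (g n t) Z ≤ M) :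
    ∃ b : ℝ≥0 → X, Isometry b ∧ b 0 = o ∧ ∀ t, Metric.infDist (b t) Z ≤ M := by
  -- Pointwise ultralimits in compact balls replace an Arzelà–Ascoli subsequence.
  let F : Ultrafilter ℕ := hyperfilter ℕ
  have hF : (F : Filter ℕ) ≤ atTop := Nat.hyperfilter_le_atTop
  have hev : ∀ t : ℝ≥0, ∀ᶠ n in (F : Filter ℕ), (t : ℝ) ∈ Icc 0 (ℓ n) := fun t =>
    hF ((hℓ.eventually_ge_atTop (t : ℝ)).mono fun n hn => ⟨t.2, hn⟩)
  have hlim : ∀ t : ℝ≥0, ∃ x, Tendsto (fun n => g n t) F (𝓝 x) := by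
    intro t
    have hball : ∀ᶠ n in (F : Filter ℕ), g n t ∈ Metric.closedBall o t := by
      filter_upwards [hev t] with n hn
      have := hg n t hn 0 ⟨le_rfl, hn.1.trans hn.2⟩
      rw [h0, sub_zero, NNReal.abs_eq] at this
      exact this.le
    obtain ⟨x, -, hx⟩ := (isCompact_closedBall o (t : ℝ)).ultrafilter_le_nhds
      (F.map fun n => g n t) (le_principal_iff.2 hball)
    exact ⟨x, hx⟩
  choose b hb using hlim
  refine ⟨b, Isometry.of_dist_eq fun s t => ?_, ?_, fun t => ?_⟩
  · refine tendsto_nhds_unique ((hb s).dist (hb t)) (tendsto_const_nhds.congr' ?_)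
    filter_upwards [hev s, hev t] with n hs ht
    rw [hg n s hs t ht, NNReal.dist_eq]
  · exact tendsto_nhds_unique (hb 0) (by simp [h0])
  · refine le_of_tendsto (((Metric.continuous_infDist_pt Z).tendsto _).comp (hb t)) ?_
    filter_upwards [hev t] with n hn
    exact hM n t hn

theorem IsQuasiGeodesicRay.tendsto_dist {q Q : ℝ} {α : ℝ≥0 → X} (hq : 1 ≤ q)
    (h : IsQuasiGeodesicRay q Q α) : Tendsto (fun t => dist (α 0) (α t)) atTop atTop := by
  have h1 : Tendsto (fun t : ℝ≥0 => (t : ℝ) / q - Q) atTop atTop :=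
    tendsto_atTop_add_const_right _ _
      ((NNReal.tendsto_coe_atTop.2 tendsto_id).atTop_div_const (by linarith))
  refine tendsto_atTop_mono (fun t => ?_) h1
  have := (h 0 t).1
  rwa [NNReal.dist_eq, NNReal.coe_zero, zero_sub, abs_neg, NNReal.abs_eq] at this

/-- A sequence with bounded jumps tending to infinity passes within the jump bound of every real
beyond its start. -/
theorem exists_abs_sub_le_of_tendsto {u : ℕ → ℝ} {J : ℝ} (hu : Tendsto u atTop atTop)
    (hJ : ∀ n, |u (n + 1) - u n| ≤ J) {x : ℝ} (hx : u 0 ≤ x) : ∃ n, |x - u n| ≤ J := by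
  classical
  have hex : ∃ n, x < u n := (hu.eventually_gt_atTop x).exists
  have h1 := Nat.find_spec hex
  obtain ⟨k, hk⟩ : ∃ k, Nat.find hex = k + 1 := by
    refine Nat.exists_eq_succ_of_ne_zero fun h => ?_
    rw [h] at h1
    linarith
  have h2 := Nat.find_min hex (m := k) (by omega)
  rw [hk] at h1
  refine ⟨k, ?_⟩
  have := (le_abs_self _).trans (hJ k)
  rw [abs_of_nonneg (by linarith)]
  linarith

theorem isQuasiGeodesicOn_of_isometry {a b : ℝ} {γ : ℝ → X}
    (h : ∀ s ∈ Icc a b, ∀ t ∈ Icc a b, dist (γ s) (γ t) = |s - t|) :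
    IsQuasiGeodesicOn 1 0 γ a b := by
  intro s hs t ht
  rw [h s hs t ht]
  simp

theorem continuousOn_of_dist_eq {s : Set ℝ} {γ : ℝ → X}
    (h : ∀ u ∈ s, ∀ v ∈ s, dist (γ u) (γ v) = |u - v|) : ContinuousOn γ s := by
  refine LipschitzOnWith.continuousOn (K := 1) (LipschitzOnWith.of_dist_le_mul fun u hu v hv => ?_)
  rw [h u hu v hv, Real.dist_eq]
  simp

/-- Every contracting quasi-geodesic ray is at finite Hausdorff distance from a geodesic ray. -/
theorem exists_isometry_hausdorffEDist_ne_top [ProperSpace X] (hX : IsGeodesicSpace X) {o : X}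
    (α : ContractingRay o) : ∃ b : ℝ≥0 → X, Isometry b ∧ b 0 = o ∧
      Metric.hausdorffEDist α.image (range b) ≠ ⊤ := by
  obtain ⟨q, Q, hq, hQ, hα⟩ := α.quasiGeodesic
  obtain ⟨ρ, hρ, hZ⟩ := α.contracting
  have hq0 : 0 < q := by linarith
  have hne : (range α.toFun).Nonempty := range_nonempty _
  have hoZ : o ∈ range α.toFun := ⟨0, α.map_zero⟩
  choose g g0 g1 hg using fun n : ℕ => hX o (α.toFun n)
  set κ := kappa ρ 1 0
  have hκ0 : 0 ≤ κ := by linarith [three_le_kappa ρ le_rfl 0]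
  set M := κ + 8 * 1 ^ 2 * (2 * κ + 0) + 0
  obtain ⟨b, hb, hb0, hbM⟩ := exists_isometry_of_segments (Z := range α.toFun) (M := M)
    (fun n : ℕ => dist o (α.toFun n)) (by
      have := (hα.tendsto_dist hq).comp (tendsto_natCast_atTop_atTop (R := ℝ≥0))
      rw [α.map_zero] at this
      exact this) g g0 hg fun n t ht => by
    refine infDist_le_of_endpoints hρ hZ hne le_rfl le_rfl
      (isQuasiGeodesicOn_of_isometry (hg n)) (continuousOn_of_dist_eq (hg n)) le_rfl ?_ ?_ ht
    · rw [g0, Metric.infDist_zero_of_mem hoZ]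
      exact hκ0
    · rw [g1, Metric.infDist_zero_of_mem (mem_range_self _)]
      exact hκ0
  refine ⟨b, hb, hb0, ?_⟩
  have hM0 : 0 ≤ M := Metric.infDist_nonneg.trans (hbM 0)
  have hnear : ∀ t : ℝ≥0, ∃ u : ℝ≥0, dist (b t) (α.toFun u) ≤ M := by
    intro t
    obtain ⟨p, ⟨u, rfl⟩, hp⟩ := exists_mem_proj hZ.1 hne (b t)
    exact ⟨u, hp.trans_le (hbM t)⟩
  choose u hu using hnear
  have hlow : ∀ s t : ℝ≥0, dist s t ≤ q * (dist (α.toFun s) (α.toFun t) + Q) := by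
    intro s t
    have := (hα s t).1
    rw [sub_le_iff_le_add, div_le_iff₀ hq0] at this
    linarith
  have hbd : ∀ s t : ℝ≥0, dist (u s) (u t) ≤ q * (2 * M + dist s t + Q) := by
    intro s t
    refine (hlow _ _).trans ?_
    gcongr
    have h1 := dist_triangle4 (α.toFun (u s)) (b s) (b t) (α.toFun (u t))
    rw [hb.dist_eq, dist_comm _ (b s)] at h1
    linarith [hu s, hu t]
  -- The converse inclusion is a discrete connectedness argument: the parameters `u n` tend to
  -- infinity with bounded jumps, so they are coarsely dense beyond `u 0`.
  have hutop : Tendsto (fun n : ℕ => (u n : ℝ)) atTop atTop := by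
    have h1 : Tendsto (fun n : ℕ => ((n : ℝ) - M - Q) / q) atTop atTop :=
      (tendsto_atTop_add_const_right _ _ (tendsto_atTop_add_const_right _ _
        tendsto_natCast_atTop_atTop)).atTop_div_const hq0
    refine tendsto_atTop_mono (fun n => ?_) h1
    have h2 := (hα 0 (u n)).2
    rw [α.map_zero, NNReal.dist_eq, NNReal.coe_zero, zero_sub, abs_neg, NNReal.abs_eq] at h2
    have h3 := hb.dist_eq 0 n
    rw [hb0, NNReal.dist_eq, NNReal.coe_zero, zero_sub, abs_neg, NNReal.abs_eq] at h3
    have h4 := dist_triangle_right o (b n) (α.toFun (u n))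
    have h5 := hu n
    rw [div_le_iff₀ hq0]
    simp only [NNReal.coe_natCast] at h2 h3 ⊢
    linarith
  set J := q * (2 * M + 1 + Q)
  have hJ0 : 0 ≤ J := by positivity
  have hjump : ∀ n : ℕ, |((u (n + 1 : ℕ) : ℝ)) - u n| ≤ J := by
    intro n
    have := hbd (n + 1 : ℕ) n
    rw [NNReal.dist_eq, NNReal.dist_eq] at this
    simpa using this
  set K : ℝ := q * (J + u 0) + Q + M
  have hK0 : 0 ≤ K := by positivity
  refine hausdorffEDist_ne_top_iff.2 ⟨K.toNNReal, ?_, ?_⟩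
  · rw [Real.coe_toNNReal _ hK0]
    rintro _ ⟨s, rfl⟩
    have hfin : ∀ n : ℕ, |(s : ℝ) - u n| ≤ J + u 0 → dist (α.toFun s) (b n) ≤ K := by
      intro n hn
      have h1 := (hα s (u n)).2
      rw [NNReal.dist_eq] at h1
      have h2 := mul_le_mul_of_nonneg_left hn hq0.le
      have h3 := dist_triangle_right (α.toFun s) (b n) (α.toFun (u n))
      linarith [hu n]
    rcases le_total (u (0 : ℕ) : ℝ) s with hs | hs
    · obtain ⟨n, hn⟩ := exists_abs_sub_le_of_tendsto hutop hjump hs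
      exact ⟨b n, mem_range_self _, hfin n (hn.trans (by simp))⟩
    · refine ⟨b (0 : ℕ), mem_range_self _, hfin 0 ?_⟩
      rw [abs_sub_comm, abs_of_nonneg (by linarith)]
      simp only [Nat.cast_zero]
      linarith [s.2, NNReal.coe_nonneg s]
  · rw [Real.coe_toNNReal _ hK0]
    rintro _ ⟨t, rfl⟩
    refine ⟨_, mem_range_self (u t), (hu t).trans ?_⟩
    have : 0 ≤ q * (J + u 0) + Q := by positivity
    linarith

theorem Isometry.isQuasiGeodesicRay {b : ℝ≥0 → X} (hb : Isometry b) : IsQuasiGeodesicRay 1 0 b :=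
  fun s t => by simp [hb.dist_eq]

/-- Contracting geodesic representatives exist. -/
theorem nonempty_repSystem [ProperSpace X] (hX : IsGeodesicSpace X) (o : X) :
    Nonempty (RepSystem o) := by
  have key : ∀ ζ : Boundary o, ∃ β : ContractingRay o, Isometry β.toFun ∧ β.toBoundary = ζ := by
    intro ζ
    induction ζ using Quotient.inductionOn with
    | h α =>
      obtain ⟨b, hb, hb0, hd⟩ := exists_isometry_hausdorffEDist_ne_top hX α
      refine ⟨⟨b, hb0, ⟨1, 0, le_rfl, le_rfl, Isometry.isQuasiGeodesicRay hb⟩,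
        α.contracting.of_hausdorffEDist_ne_top hX hb.isClosedEmbedding.isClosed_range
          (range_nonempty _) hd⟩, hb, ?_⟩
      refine Quotient.sound ?_
      show Metric.hausdorffEDist (range b) α.image ≠ ⊤
      rwa [Metric.hausdorffEDist_comm]
  choose ray h1 h2 using key
  choose gauge h3 h4 using fun ζ => (ray ζ).contracting
  exact ⟨⟨ray, gauge, h1, h2, h3, h4⟩⟩

end ContractingBoundary

/-! ### Morse estimates for rays, and surgery. -/

namespace ContractingBoundary

open Filter Set

variable {X : Type*} [MetricSpace X]

section Rays

theorem IsQuasiGeodesicRay.isQuasiGeodesicOn {q Q : ℝ} {α : ℝ≥0 → X}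
    (h : IsQuasiGeodesicRay q Q α) {b : ℝ} :
    IsQuasiGeodesicOn q Q (fun t : ℝ => α t.toNNReal) 0 b := by
  intro s hs t ht
  have := h s.toNNReal t.toNNReal
  rwa [NNReal.dist_eq, Real.coe_toNNReal _ hs.1, Real.coe_toNNReal _ ht.1] at this

theorem dist_zero_isometry {b : ℝ≥0 → X} (hb : Isometry b) {o : X} (h0 : b 0 = o) (t : ℝ≥0) :
    dist o (b t) = t := by
  rw [← h0, hb.dist_eq, NNReal.dist_eq, NNReal.coe_zero, zero_sub, abs_neg, NNReal.abs_eq]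

/-- The constant in the Morse property for a neighbourhood of radius `C`. -/
def morseConst (q Q C : ℝ) : ℝ := C + 8 * q ^ 2 * (2 * C + Q) + Q

theorem morseConst_mono {q q' Q Q' C : ℝ} (hq : 0 ≤ q) (hqq : q ≤ q') (hQ : 0 ≤ Q)
    (hQQ : Q ≤ Q') (hC : 0 ≤ C) : morseConst q Q C ≤ morseConst q' Q' C := by
  unfold morseConst
  gcongr

theorem le_morseConst {q Q C : ℝ} (hQ : 0 ≤ Q) (hC : 0 ≤ C) : C ≤ morseConst q Q C := by
  unfold morseConst
  have : 0 ≤ 8 * q ^ 2 * (2 * C + Q) := by positivity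
  linarith

variable {o : X} {ρ : ℝ≥0 → ℝ≥0} {b α : ℝ≥0 → X} {q Q : ℝ}

theorem dist_isometry_le_of_infDist_le [ProperSpace X] (hb : Isometry b) (hb0 : b 0 = o) {x : X}
    {M : ℝ} {H : ℝ≥0} (hx : Metric.infDist x (range b) ≤ M) (hH : dist o x = H) :
    dist x (b H) ≤ 2 * M := by
  obtain ⟨p, ⟨s, rfl⟩, hp⟩ := exists_mem_proj hb.isClosedEmbedding.isClosed_range
    (range_nonempty b) x
  have h1 : dist (b s) (b H) ≤ M := by
    rw [hb.dist_eq, NNReal.dist_eq, ← dist_zero_isometry hb hb0 s, ← hH, dist_comm o, dist_comm o,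
      dist_comm x o, dist_comm o x]
    refine (abs_dist_sub_le _ _ _).trans ?_
    rw [dist_comm]
    exact hp.trans_le hx
  have := dist_triangle x (b s) (b H)
  rw [hp] at this
  linarith

variable [ProperSpace X]

theorem infDist_le_morseConst (hρ : IsSublinear ρ) (hb0 : b 0 = o)
    (hZ : IsContractingWith ρ (range b)) (hq : 1 ≤ q) (hQ : 0 ≤ Q) (hα : IsQuasiGeodesicRay q Q α)
    (hc : Continuous α) (hα0 : α 0 = o) {T R : ℝ≥0} {C : ℝ} (hC : kappa ρ q Q ≤ C)
    (hT : dist (α T) (b R) ≤ C) {t : ℝ≥0} (ht : t ≤ T) :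
    Metric.infDist (α t) (range b) ≤ morseConst q Q C := by
  have h : _ ≤ morseConst q Q C := infDist_le_of_endpoints (t := t) hρ hZ (range_nonempty b) hq hQ
    (hα.isQuasiGeodesicOn (b := T)) (hc.comp continuous_real_toNNReal).continuousOn hC ?_ ?_
    ⟨t.2, by exact_mod_cast ht⟩
  · simpa only [Real.toNNReal_coe] using h
  · rw [Real.toNNReal_zero, hα0, ← hb0, Metric.infDist_zero_of_mem (mem_range_self _)]
    exact dist_nonneg.trans hT
  · rw [Real.toNNReal_coe]
    exact (Metric.infDist_le_dist_of_mem (mem_range_self R)).trans hT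

/-- This recovers the sharp constant `κ` demanded by `nbhd` from closeness with an arbitrary `C`.
Going back from `α T` to the last visit of the `κ`-neighbourhood costs a bounded distance, which the
size of `R` absorbs. -/
theorem exists_dist_le_kappa (hρ : IsSublinear ρ) (hb : Isometry b) (hb0 : b 0 = o)
    (hZ : IsContractingWith ρ (range b)) (hq : 1 ≤ q) (hQ : 0 ≤ Q) (hα : IsQuasiGeodesicRay q Q α)
    (hc : Continuous α) (hα0 : α 0 = o) {T R : ℝ≥0} {C r : ℝ} (hT : dist (α T) (b R) ≤ C)
    (hR : r + kappa ρ q Q + C + (8 * q ^ 2 * (kappa ρ q Q + C + Q) + Q) ≤ R) :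
    ∃ t s : ℝ≥0, r ≤ s ∧ dist (α t) (b s) ≤ kappa ρ q Q := by
  obtain ⟨t, -, h1, h2⟩ := exists_infDist_le_kappa (C := C) hρ hZ (range_nonempty b) hq hQ
    (hα.isQuasiGeodesicOn (b := T)) (hc.comp continuous_real_toNNReal).continuousOn T.2 (by
      rw [Real.toNNReal_zero, hα0, ← hb0, Metric.infDist_zero_of_mem (mem_range_self _)]
      linarith [three_le_kappa ρ hq Q]) (by
      simp only [Real.toNNReal_coe]
      exact (Metric.infDist_le_dist_of_mem (mem_range_self R)).trans hT)
  simp only [Real.toNNReal_coe] at h1 h2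
  obtain ⟨p, ⟨s, rfl⟩, hp⟩ := exists_mem_proj hZ.1 (range_nonempty b) (α t.toNNReal)
  refine ⟨t.toNNReal, s, ?_, hp.trans_le h1⟩
  have h3 : dist (b s) (b R) ≤ kappa ρ q Q + (8 * q ^ 2 * (kappa ρ q Q + C + Q) + Q) + C := by
    have := dist_triangle4 (b s) (α t.toNNReal) (α T) (b R)
    rw [dist_comm (b s) (α t.toNNReal), hp] at this
    linarith
  rw [hb.dist_eq, NNReal.dist_eq] at h3
  linarith [(abs_le.1 h3).1]

end Rays

section Surgery

theorem isQuasiGeodesicRay_of_le {q Q : ℝ} (hq : 0 < q) {β : ℝ≥0 → X}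
    (h : ∀ u v : ℝ≥0, u ≤ v → (v - u : ℝ) ≤ q * (dist (β u) (β v) + Q) ∧
      dist (β u) (β v) ≤ q * (v - u) + Q) : IsQuasiGeodesicRay q Q β := by
  have key : ∀ u v : ℝ≥0, u ≤ v →
      dist u v / q - Q ≤ dist (β u) (β v) ∧ dist (β u) (β v) ≤ q * dist u v + Q := by
    intro u v huv
    have : (u : ℝ) ≤ v := by exact_mod_cast huv
    rw [NNReal.dist_eq, abs_sub_comm, abs_of_nonneg (sub_nonneg.2 this), sub_le_iff_le_add,
      div_le_iff₀ hq, mul_comm _ q]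
    exact h u v huv
  intro u v
  rcases le_total u v with huv | huv
  · exact key u v huv
  · rw [dist_comm u v, dist_comm (β u)]
    exact key v u huv

/-- Surgery: follow `α` up to some point near the sphere of radius `H`, cross to the geodesic ray
`γ` outside the ball of radius `2 * H` along a shortest segment, and continue along `γ`. -/
theorem exists_surgery [ProperSpace X] (hX : IsGeodesicSpace X) {o : X} {q Q : ℝ} {α γ : ℝ≥0 → X}
    (hq : 1 ≤ q) (hQ : 0 ≤ Q) (hα : IsQuasiGeodesicRay q Q α) (hc : Continuous α) (hα0 : α 0 = o)
    (hγ : Isometry γ) (hγ0 : γ 0 = o) {H : ℝ≥0} {C : ℝ} {S : ℝ≥0}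
    (hS : ∀ t ≤ S, dist o (α t) ≤ H) (hC : dist (α S) (γ (2 * H)) ≤ H + C) :
    ∃ β : ℝ≥0 → X, Continuous β ∧ β 0 = o ∧ IsQuasiGeodesicRay (2 * q + 4) Q β ∧
      Metric.hausdorffEDist (range γ) (range β) ≠ ⊤ ∧
      ∃ s, (∀ t ≤ s, β t = α t) ∧ H - C ≤ dist o (α s) := by
  have hdγ := dist_zero_isometry hγ hγ0
  have hZcl : IsClosed (γ '' Ici (2 * H)) := hγ.isClosedEmbedding.isClosedMap _ isClosed_Ici
  have hZne : (γ '' Ici (2 * H)).Nonempty := nonempty_Ici.image _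
  -- Leaving `α` at the point nearest to the tail of `γ` makes the connecting segment shortest from
  -- both ends, which prevents backtracking.
  obtain ⟨s, hsS, hmin⟩ := (isCompact_Icc (a := (0 : ℝ≥0)) (b := S)).exists_isMinOn
    (nonempty_Icc.2 zero_le)
    ((Metric.continuous_infDist_pt (γ '' Ici (2 * H))).comp hc).continuousOn
  obtain ⟨_, ⟨τ, hτ, rfl⟩, hδ⟩ := exists_mem_proj hZcl hZne (α s)
  obtain ⟨c, c0, c1, hcd⟩ := hX (α s) (γ τ)
  set δ := dist (α s) (γ τ) with hδdef
  have hδ0 : 0 ≤ δ := dist_nonneg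
  have hδmin : ∀ t ≤ S, ∀ t', 2 * H ≤ t' → δ ≤ dist (α t) (γ t') := by
    intro t ht t' ht'
    rw [hδ]
    exact (hmin ⟨zero_le, ht⟩).trans (Metric.infDist_le_dist_of_mem (mem_image_of_mem _ ht'))
  have hH0 : (0 : ℝ) ≤ H := H.2
  have hτ' : 2 * (H : ℝ) ≤ τ := by exact_mod_cast hτ
  have hoδ : τ ≤ dist o (α s) + δ := by
    have := dist_triangle o (α s) (γ τ)
    rwa [hdγ] at this
  have hoδ' : δ ≤ dist o (α s) + τ := by
    have := dist_triangle_left (α s) (γ τ) o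
    rwa [hdγ] at this
  have hsH := hS s hsS.2
  have m0 : (0 : ℝ) ∈ Icc 0 δ := ⟨le_rfl, hδ0⟩
  have m1 : δ ∈ Icc 0 δ := ⟨hδ0, le_rfl⟩
  have cs : ∀ x ∈ Icc 0 δ, dist (α s) (c x) = x := by
    intro x hx
    have := hcd 0 m0 x hx
    rwa [c0, zero_sub, abs_neg, abs_of_nonneg hx.1] at this
  have cτ : ∀ x ∈ Icc 0 δ, dist (c x) (γ τ) = δ - x := by
    intro x hx
    have := hcd x hx δ m1
    rwa [c1, abs_sub_comm, abs_of_nonneg (sub_nonneg.2 hx.2)] at this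
  -- The segment `c` is controlled only on `[0, δ]`; clamping its parameter makes the middle piece
  -- continuous on all of `ℝ`.
  let β' : ℝ → X := fun t => if t ≤ s then α t.toNNReal else
    if t ≤ s + δ then c (max 0 (min (t - s) δ)) else γ (t - s - δ + τ).toNNReal
  have hclamp : ∀ x ∈ Icc 0 δ, max 0 (min x δ) = x := fun x hx => by
    rw [min_eq_left hx.2, max_eq_right hx.1]
  have hβA : ∀ t : ℝ, t ≤ s → β' t = α t.toNNReal := fun t ht => if_pos ht
  have hβB : ∀ t : ℝ, s ≤ t → t ≤ s + δ → β' t = c (t - s) := by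
    intro t h1 h2
    have hm : t - s ∈ Icc 0 δ := ⟨by linarith, by linarith⟩
    rcases h1.eq_or_lt with rfl | h1
    · rw [hβA _ le_rfl, Real.toNNReal_coe, sub_self, c0]
    · simp only [β', if_neg (not_le.2 h1), if_pos h2, hclamp _ hm]
  have hβC : ∀ t : ℝ, s + δ ≤ t → β' t = γ (t - s - δ + τ).toNNReal := by
    intro t h1
    rcases h1.eq_or_lt with rfl | h1
    · rw [hβB _ (by linarith) le_rfl]
      simp [c1]
    · simp only [β', if_neg (not_le.2 h1), if_neg (not_le.2 (show (s : ℝ) < t by linarith))]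
  have hcc : Continuous fun x : ℝ => c (max 0 (min x δ)) :=
    (continuousOn_of_dist_eq hcd).comp_continuous (by fun_prop)
      fun x => ⟨le_max_left _ _, max_le hδ0 (min_le_right _ _)⟩
  have hβc : Continuous β' := by
    refine Continuous.if_le (hc.comp continuous_real_toNNReal) (Continuous.if_le
      (hcc.comp (continuous_id.sub continuous_const)) (hγ.continuous.comp
        (continuous_real_toNNReal.comp (by fun_prop))) continuous_id continuous_const ?_)
      continuous_id continuous_const ?_
    · rintro x rfl
      simp [hδ0, c1]
    · rintro x rfl
      simp [hδ0, c0]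
  have hβ0 : β' 0 = o := by rw [hβA 0 s.2, Real.toNNReal_zero, hα0]
  have hα_low : ∀ u v : ℝ≥0, u ≤ v → (v - u : ℝ) ≤ q * (dist (α u) (α v) + Q) := by
    intro u v huv
    have h1 : (u : ℝ) ≤ v := by exact_mod_cast huv
    have := (hα u v).1
    rw [NNReal.dist_eq, abs_sub_comm, abs_of_nonneg (sub_nonneg.2 h1), sub_le_iff_le_add,
      div_le_iff₀ (by linarith)] at this
    linarith
  have hα_up : ∀ u v : ℝ≥0, u ≤ v → dist (α u) (α v) ≤ q * (v - u) + Q := by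
    intro u v huv
    have h1 : (u : ℝ) ≤ v := by exact_mod_cast huv
    have := (hα u v).2
    rwa [NNReal.dist_eq, abs_sub_comm, abs_of_nonneg (sub_nonneg.2 h1)] at this
  have hqQ : 0 ≤ q * Q := by positivity
  have hγC : ∀ t : ℝ, s + δ ≤ t → ((t - s - δ + τ).toNNReal : ℝ) = t - s - δ + τ := fun t ht =>
    Real.coe_toNNReal _ (by have := NNReal.coe_nonneg τ; linarith)
  have hq0 : 0 ≤ q := by linarith
  have low : ∀ {L d : ℝ}, 0 ≤ d → L ≤ q * (2 * d + Q) + 4 * d → L ≤ (2 * q + 4) * (d + Q) := by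
    intro L d hd h
    linarith
  have up : ∀ {L d : ℝ} (x y : ℝ), 0 ≤ x → 0 ≤ y → x + y = L → d ≤ q * x + Q + y →
      d ≤ (2 * q + 4) * L + Q := by
    rintro L d x y hx hy rfl hd
    have h1 : 0 ≤ q * x := by positivity
    have h2 : 0 ≤ q * y := by positivity
    linarith
  refine ⟨fun t => β' t, hβc.comp NNReal.continuous_coe, hβ0, ?_, ?_, s, fun t ht => ?_, ?_⟩
  · refine isQuasiGeodesicRay_of_le (by linarith) fun u v huv => ?_
    have huv' : (u : ℝ) ≤ v := by exact_mod_cast huv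
    rcases le_total (u : ℝ) s with hu | hu
    · rw [hβA u hu, Real.toNNReal_coe]
      have hus : u ≤ s := by exact_mod_cast hu
      have huS : u ≤ S := hus.trans hsS.2
      rcases le_total (v : ℝ) s with hv | hv
      · rw [hβA v hv, Real.toNNReal_coe]
        have h1 := hα_low u v huv
        have h2 := hα_up u v huv
        have h3 : 0 ≤ dist (α u) (α v) := dist_nonneg
        exact ⟨low (by linarith) (by linarith [mul_nonneg hq0 (dist_nonneg : 0 ≤ dist (α u) (α v))]),
          up (v - u) 0 (by linarith) (by linarith) (by linarith) (by linarith)⟩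
      have h1 := hα_low u s hus
      have h2 := hα_up u s hus
      rcases le_total (v : ℝ) (s + δ) with hv' | hv'
      · rw [hβB v hv hv']
        have hx : (v - s : ℝ) ∈ Icc 0 δ := ⟨by linarith, by linarith⟩
        have h3 := cs _ hx
        have h4 := cτ _ hx
        have h5 := hδmin u huS τ hτ
        have h6 := dist_triangle (α u) (c (v - s)) (γ τ)
        have h7 := dist_triangle (α u) (α s) (c (v - s))
        have h8 := dist_triangle_right (α u) (α s) (c (v - s))
        have h9 : 0 ≤ dist (α u) (c (v - s)) := dist_nonneg
        have h10 : q * dist (α u) (α s) ≤ q * (2 * dist (α u) (c (v - s))) := by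
          gcongr
          linarith
        exact ⟨low (by linarith) (by linarith [mul_nonneg hq0 (dist_nonneg :
            0 ≤ dist (α u) (c (v - s)))]),
          up (s - u) (v - s) (by linarith) (by linarith) (by linarith) (by linarith)⟩
      · rw [hβC v hv']
        have e := hγC v hv'
        generalize (v - s - δ + τ : ℝ).toNNReal = t' at e
        have h3 := hdγ t'
        have h4 := dist_triangle o (α u) (γ t')
        have h5 := hS u huS
        have h6 := hα_low 0 s zero_le
        rw [hα0, NNReal.coe_zero] at h6
        -- `α u` is within `H` of `o` and `γ t'` at least `2 * H` away, so their distance is at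
        -- least `H` and controls both the time spent on `α` and the length of the crossing.
        have h7 : q * dist o (α s) ≤ q * dist (α u) (γ t') := by
          gcongr
          linarith
        have h8 : 0 ≤ dist (α u) (γ t') := dist_nonneg
        have h9 := dist_triangle4 (α u) (α s) (γ τ) (γ t')
        have h10 : dist (γ τ) (γ t') = t' - τ := by
          rw [hγ.dist_eq, NNReal.dist_eq, abs_sub_comm, abs_of_nonneg (by linarith)]
        have h11 : 0 ≤ (u : ℝ) := u.2
        exact ⟨low (by linarith) (by linarith [mul_nonneg hq0 (dist_nonneg : 0 ≤ dist (α u) (γ t'))]),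
          up (s - u) (v - s) (by linarith) (by linarith) (by linarith) (by linarith)⟩
    · have hv : (s : ℝ) ≤ v := hu.trans huv'
      rcases le_total (u : ℝ) (s + δ) with hu' | hu'
      · rw [hβB u hu hu']
        have hx : (u - s : ℝ) ∈ Icc 0 δ := ⟨by linarith, by linarith⟩
        rcases le_total (v : ℝ) (s + δ) with hv' | hv'
        · rw [hβB v hv hv']
          have hy : (v - s : ℝ) ∈ Icc 0 δ := ⟨by linarith, by linarith⟩
          have h1 := hcd _ hx _ hy
          rw [abs_sub_comm, abs_of_nonneg (by linarith)] at h1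
          rw [h1]
          exact ⟨low (by linarith) (by linarith [mul_nonneg hq0 (sub_nonneg.2 huv' : 0 ≤ (v - u : ℝ))]),
          up 0 (v - u) (by linarith) (by linarith) (by linarith) (by linarith)⟩
        · rw [hβC v hv']
          have e := hγC v hv'
          generalize (v - s - δ + τ : ℝ).toNNReal = t' at e
          have h3 := cs _ hx
          have h4 := cτ _ hx
          have hτt : (τ : ℝ) ≤ t' := by linarith
          have h5 := hδmin s hsS.2 t' (hτ.trans (by exact_mod_cast hτt))
          have h6 := dist_triangle (α s) (c (u - s)) (γ t')
          have h10 : dist (γ τ) (γ t') = t' - τ := by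
            rw [hγ.dist_eq, NNReal.dist_eq, abs_sub_comm, abs_of_nonneg (by linarith)]
          have h7 := dist_triangle (c (u - s)) (γ τ) (γ t')
          have h8 := dist_triangle_left (γ τ) (γ t') (c (u - s))
          have h9 : 0 ≤ dist (c (u - s)) (γ t') := dist_nonneg
          exact ⟨low (by linarith) (by linarith [mul_nonneg hq0 (dist_nonneg :
            0 ≤ dist (c (u - s)) (γ t'))]),
          up 0 (v - u) (by linarith) (by linarith) (by linarith) (by linarith)⟩
      · have hv' : s + δ ≤ v := hu'.trans huv'
        rw [hβC u hu', hβC v hv', hγ.dist_eq, NNReal.dist_eq, hγC u hu', hγC v hv',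
          abs_sub_comm, abs_of_nonneg (by linarith)]
        exact ⟨low (by linarith) (by linarith [mul_nonneg hq0 (sub_nonneg.2 huv' : 0 ≤ (v - u : ℝ))]),
          up 0 (v - u) (by linarith) (by linarith) (by linarith) (by linarith)⟩
  · set K : ℝ := H + δ + τ
    have hK0 : 0 ≤ K := by positivity
    refine hausdorffEDist_ne_top_iff.2 ⟨K.toNNReal, ?_, ?_⟩
    · rw [Real.coe_toNNReal _ hK0]
      rintro _ ⟨t, rfl⟩
      rcases le_total τ t with h | h
      · have h' : (τ : ℝ) ≤ t := by exact_mod_cast h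
        refine ⟨_, mem_range_self (t - τ + s + δ : ℝ).toNNReal, ?_⟩
        have e : ((t - τ + s + δ : ℝ).toNNReal : ℝ) = t - τ + s + δ :=
          Real.coe_toNNReal _ (by have := NNReal.coe_nonneg s; linarith)
        have e2 : (t - τ + s + δ - s - δ + τ : ℝ) = t := by ring
        rw [e, hβC _ (by linarith), e2, Real.toNNReal_coe, dist_self]
        exact hK0
      · refine ⟨_, mem_range_self 0, ?_⟩
        have h' : (t : ℝ) ≤ τ := by exact_mod_cast h
        rw [NNReal.coe_zero, hβ0, dist_comm, hdγ]
        linarith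
    · rw [Real.coe_toNNReal _ hK0]
      rintro _ ⟨t, rfl⟩
      have hτ0 := NNReal.coe_nonneg τ
      show ∃ y ∈ range γ, dist (β' t) y ≤ K
      rcases le_total (s + δ) (t : ℝ) with h | h
      · rw [hβC t h]
        exact ⟨_, mem_range_self _, by rw [dist_self]; exact hK0⟩
      · refine ⟨_, mem_range_self 0, ?_⟩
        rw [hγ0, dist_comm]
        rcases le_total (t : ℝ) s with h' | h'
        · rw [hβA t h', Real.toNNReal_coe]
          have := hS t (le_trans (by exact_mod_cast h') hsS.2)
          linarith
        · rw [hβB t h' h]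
          have := cs (t - s) ⟨by linarith, by linarith⟩
          linarith [dist_triangle o (α s) (c (t - s))]
  · have h : (t : ℝ) ≤ s := by exact_mod_cast ht
    show β' t = α t
    rw [hβA t h, Real.toNNReal_coe]
  -- The crossing has length at most `H + C` and reaches radius `2 * H`, so it starts at radius at
  -- least `H - C`.
  · have h1 := hδmin S le_rfl (2 * H) le_rfl
    linarith

theorem IsQuasiGeodesicRay.isClosed_range [ProperSpace X] {q Q : ℝ} (hq : 1 ≤ q) {β : ℝ≥0 → X}
    (h : IsQuasiGeodesicRay q Q β) (hc : Continuous β) : IsClosed (range β) := by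
  have h1 : Tendsto β (cocompact ℝ≥0) (cocompact X) := by
    refine tendsto_cocompact_of_tendsto_dist_comp_atTop (β 0) ?_
    have := h.tendsto_dist hq
    rw [cocompact_eq_atTop]
    simpa only [dist_comm] using this
  exact (isProperMap_iff_tendsto_cocompact.2 ⟨hc, h1⟩).isClosedMap.isClosed_range

end Surgery

end ContractingBoundary

/-! ### The neighbourhoods `U(ζ, r)` and Frink's condition. -/

namespace ContractingBoundary

open Filter Set

variable {X : Type*} [MetricSpace X] {o : X}

theorem setDist_le {A B : Set X} {x y : X} (hx : x ∈ A) (hy : y ∈ B) : setDist A B ≤ dist x y :=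
  csInf_le ⟨0, by rintro _ ⟨a, -, b, -, rfl⟩; exact dist_nonneg⟩ (mem_image2_of_mem hx hy)

namespace RepSystem

variable (S : RepSystem o)

theorem mem_image_inter_compl_ball {ζ : Boundary o} {r : ℝ} {s : ℝ≥0} (hs : r ≤ s) :
    (S.ray ζ).toFun s ∈ (S.ray ζ).image ∩ (Metric.ball o r)ᶜ := by
  refine ⟨mem_range_self s, ?_⟩
  rw [mem_compl_iff, Metric.mem_ball, not_lt, dist_comm,
    dist_zero_isometry (S.isometry_ray ζ) (S.ray ζ).map_zero]
  exact hs

theorem exists_dist_lt_of_mem_nbhd {ζ η : Boundary o} {r : ℝ} (hη : η ∈ S.nbhd ζ r) {q Q : ℝ}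
    (hq : 1 ≤ q) (hQ : 0 ≤ Q) {α : ContractingRay o} (hα : α.toBoundary = η)
    (hc : Continuous α.toFun) (hqg : IsQuasiGeodesicRay q Q α.toFun) :
    ∃ t s : ℝ≥0, r ≤ s ∧
      dist (α.toFun t) ((S.ray ζ).toFun s) < kappa (S.gauge ζ) q Q + 1 := by
  have h := (hη q Q hq hQ α hα hc hqg).trans_lt (lt_add_one _)
  obtain ⟨_, ⟨_, ⟨t, rfl⟩, _, ⟨⟨s, rfl⟩, hs⟩, rfl⟩, hlt⟩ := exists_lt_of_csInf_lt
    (Set.Nonempty.image2 (range_nonempty _)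
      ⟨_, S.mem_image_inter_compl_ball (Real.le_coe_toNNReal r)⟩) h
  refine ⟨t, s, ?_, hlt⟩
  rwa [mem_compl_iff, Metric.mem_ball, not_lt, dist_comm,
    dist_zero_isometry (S.isometry_ray ζ) (S.ray ζ).map_zero] at hs

theorem toBoundary_eq_iff {α β : ContractingRay o} :
    α.toBoundary = β.toBoundary ↔ Metric.hausdorffEDist α.image β.image ≠ ⊤ :=
  Quotient.eq

theorem isQuasiGeodesicRay_ray (ζ : Boundary o) : IsQuasiGeodesicRay 1 0 (S.ray ζ).toFun :=
  Isometry.isQuasiGeodesicRay (S.isometry_ray ζ)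

variable [ProperSpace X]

theorem mem_nbhd_self (ζ : Boundary o) (r : ℝ) : ζ ∈ S.nbhd ζ r := by
  intro q Q hq hQ α hα hc hqg
  obtain ⟨C, -, hC⟩ := hausdorffEDist_ne_top_iff.1
    (toBoundary_eq_iff.1 (hα.trans (S.ray_mem ζ).symm))
  -- Hausdorff closeness provides a point of `α` near the chosen ray at any parameter; this one is
  -- exactly what `exists_dist_le_kappa` needs.
  set R : ℝ≥0 := (r + kappa (S.gauge ζ) q Q + C +
    (8 * q ^ 2 * (kappa (S.gauge ζ) q Q + C + Q) + Q)).toNNReal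
  obtain ⟨_, ⟨T, rfl⟩, hT⟩ := hC _ (mem_range_self R)
  rw [dist_comm] at hT
  obtain ⟨t, s, hs, hd⟩ := exists_dist_le_kappa (S.sublinear_gauge ζ) (S.isometry_ray ζ)
    (S.ray ζ).map_zero (S.contracting_ray ζ) hq hQ hqg hc α.map_zero hT
    (Real.le_coe_toNNReal _)
  exact (setDist_le (mem_range_self t) (S.mem_image_inter_compl_ball hs)).trans hd

/-- The two chosen rays come close at arbitrarily large radii, so the Morse property keeps them
uniformly close at every parameter. -/
theorem eq_of_forall_mem_nbhd {ζ η : Boundary o} (h : ∀ r : ℝ, η ∈ S.nbhd ζ r) : η = ζ := by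
  set κ := kappa (S.gauge ζ) 1 0
  set C := morseConst 1 0 (κ + 1)
  have hκ : 3 ≤ κ := three_le_kappa _ le_rfl _
  have hC : κ + 1 ≤ C := le_morseConst le_rfl (by linarith)
  have hnear : ∀ t : ℝ≥0, dist ((S.ray η).toFun t) ((S.ray ζ).toFun t) ≤ 2 * C := by
    intro t
    obtain ⟨T, R, hR, hd⟩ := S.exists_dist_lt_of_mem_nbhd (h (t + (κ + 1))) le_rfl le_rfl
      (S.ray_mem η) (S.isometry_ray η).continuous (S.isQuasiGeodesicRay_ray η)
    have h1 := dist_zero_isometry (S.isometry_ray η) (S.ray η).map_zero T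
    have h2 := dist_zero_isometry (S.isometry_ray ζ) (S.ray ζ).map_zero R
    have h3 := dist_triangle o ((S.ray η).toFun T) ((S.ray ζ).toFun R)
    have htT : (t : ℝ) ≤ T := by linarith
    refine dist_isometry_le_of_infDist_le (S.isometry_ray ζ) (S.ray ζ).map_zero ?_
      (dist_zero_isometry (S.isometry_ray η) (S.ray η).map_zero t)
    exact infDist_le_morseConst (S.sublinear_gauge ζ) (S.ray ζ).map_zero
      (S.contracting_ray ζ) le_rfl le_rfl (S.isQuasiGeodesicRay_ray η)
      (S.isometry_ray η).continuous (S.ray η).map_zero (by linarith) hd.le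
      (by exact_mod_cast htT)
  rw [← S.ray_mem η, ← S.ray_mem ζ, toBoundary_eq_iff, hausdorffEDist_ne_top_iff]
  refine ⟨(2 * C).toNNReal, ?_, ?_⟩
  · rintro _ ⟨t, rfl⟩
    exact ⟨_, mem_range_self t, (hnear t).trans (Real.le_coe_toNNReal _)⟩
  · rintro _ ⟨t, rfl⟩
    refine ⟨_, mem_range_self t, ?_⟩
    rw [dist_comm]
    exact (hnear t).trans (Real.le_coe_toNNReal _)

/-- If two boundary points are close to `ζ`, then quasi-geodesics in the first class can be diverted
far out so as to end in the second class. -/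
theorem exists_diverted_ray (hX : IsGeodesicSpace X) (ζ : Boundary o) {m : ℝ} (hm : 1 ≤ m) :
    ∃ F : ℝ, 0 < F ∧ ∀ η ∈ S.nbhd ζ F, ∀ ξ ∈ S.nbhd ζ F, ∀ q Q : ℝ, 1 ≤ q → q ≤ m → 0 ≤ Q →
      Q ≤ m → ∀ α : ContractingRay o, α.toBoundary = η → Continuous α.toFun →
      IsQuasiGeodesicRay q Q α.toFun → ∃ β : ContractingRay o, β.toBoundary = ξ ∧
        Continuous β.toFun ∧ IsQuasiGeodesicRay (2 * q + 4) Q β.toFun ∧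
        ∃ s, (∀ t ≤ s, β.toFun t = α.toFun t) ∧ m ≤ dist o (α.toFun s) := by
  have hρ := S.sublinear_gauge ζ
  set κ := kappa (S.gauge ζ) m m + 1
  have hκ : 4 ≤ κ := by
    have := three_le_kappa (S.gauge ζ) hm m
    linarith
  set C := morseConst m m κ
  have hκC : κ ≤ C := le_morseConst (by linarith) (by linarith)
  -- The points at radii `H` and `2 * H` each lie within `2 * C` of the chosen ray of `ζ`, so
  -- surgery applies with error `4 * C` and leaves `α` at radius at least `H - 4 * C = m`.
  obtain ⟨H, hH⟩ : ∃ H : ℝ≥0, (H : ℝ) = 4 * C + m :=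
    ⟨⟨4 * C + m, by linarith⟩, rfl⟩
  refine ⟨2 * H + κ, by linarith [NNReal.coe_nonneg H], ?_⟩
  intro η hη ξ hξ q Q hq hqm hQ hQm α hα hc hqg
  have key : ∀ θ ∈ S.nbhd ζ (2 * H + κ), ∀ q Q : ℝ, 1 ≤ q → q ≤ m → 0 ≤ Q → Q ≤ m →
      ∀ α : ContractingRay o, α.toBoundary = θ → Continuous α.toFun →
      IsQuasiGeodesicRay q Q α.toFun → ∃ T, 2 * H ≤ dist o (α.toFun T) ∧
        ∀ t ≤ T, Metric.infDist (α.toFun t) (S.ray ζ).image ≤ C := by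
    intro θ hθ q Q hq hqm hQ hQm α hα hc hqg
    obtain ⟨T, R, hR, hd⟩ := S.exists_dist_lt_of_mem_nbhd hθ hq hQ hα hc hqg
    have hkm : kappa (S.gauge ζ) q Q ≤ kappa (S.gauge ζ) m m := kappa_mono hρ hq hqm hQm
    have hd' : dist (α.toFun T) ((S.ray ζ).toFun R) ≤ κ := by linarith
    refine ⟨T, ?_, fun t ht => ?_⟩
    · have h1 := dist_zero_isometry (S.isometry_ray ζ) (S.ray ζ).map_zero R
      have h2 := dist_triangle o (α.toFun T) ((S.ray ζ).toFun R)
      linarith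
    · refine (infDist_le_morseConst hρ (S.ray ζ).map_zero (S.contracting_ray ζ) hq hQ hqg hc
        α.map_zero (by linarith) hd' ht).trans ?_
      exact morseConst_mono (by linarith) hqm hQ hQm (by linarith)
  obtain ⟨T, hT, hTC⟩ := key η hη q Q hq hqm hQ hQm α hα hc hqg
  obtain ⟨T', hT', hTC'⟩ := key ξ hξ 1 0 le_rfl hm le_rfl (by linarith) (S.ray ξ)
    (S.ray_mem ξ) (S.isometry_ray ξ).continuous (S.isQuasiGeodesicRay_ray ξ)
  have hd := dist_zero_isometry (S.isometry_ray ξ) (S.ray ξ).map_zero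
  rw [hd] at hT'
  have hT'' : 2 * H ≤ T' := by exact_mod_cast hT'
  have hH0 : (0 : ℝ) ≤ H := H.2
  obtain ⟨u, hu, huH, hu'⟩ := exists_first_eq (f := fun t : ℝ => -dist o (α.toFun t.toNNReal))
    (a := 0) (b := T) (c := -H) T.2
    ((continuous_const.dist (hc.comp continuous_real_toNNReal)).neg).continuousOn
    (by simp [α.map_zero]) (by simp only [Real.toNNReal_coe]; linarith)
  have hU : dist o (α.toFun u.toNNReal) = H := by linarith
  have hUT : u.toNNReal ≤ T := Real.toNNReal_le_iff_le_coe.2 hu.2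
  have hfirst : ∀ t ≤ u.toNNReal, dist o (α.toFun t) ≤ H := by
    intro t ht
    have := hu' t ⟨t.2, (Real.le_toNNReal_iff_coe_le hu.1).1 ht⟩
    rw [Real.toNNReal_coe] at this
    linarith
  have h1 := dist_isometry_le_of_infDist_le (S.isometry_ray ζ) (S.ray ζ).map_zero
    (hTC _ hUT) hU
  have h2 := dist_isometry_le_of_infDist_le (S.isometry_ray ζ) (S.ray ζ).map_zero
    (hTC' _ hT'') (hd _)
  have h3 : dist ((S.ray ζ).toFun H) ((S.ray ζ).toFun (2 * H)) = H := by
    rw [(S.isometry_ray ζ).dist_eq, NNReal.dist_eq, NNReal.coe_mul, NNReal.coe_ofNat,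
      abs_sub_comm, abs_of_nonneg (by linarith)]
    ring
  have h4 : dist (α.toFun u.toNNReal) ((S.ray ξ).toFun (2 * H)) ≤ H + 4 * C := by
    have := dist_triangle4 (α.toFun u.toNNReal) ((S.ray ζ).toFun H) ((S.ray ζ).toFun (2 * H))
      ((S.ray ξ).toFun (2 * H))
    rw [dist_comm ((S.ray ζ).toFun (2 * H))] at this
    linarith
  obtain ⟨β, hβc, hβ0, hβq, hβd, s, hs, hsd⟩ := exists_surgery hX hq hQ hqg hc α.map_zero
    (S.isometry_ray ξ) (S.ray ξ).map_zero hfirst h4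
  refine ⟨⟨β, hβ0, ⟨2 * q + 4, Q, by linarith, hQ, hβq⟩,
    (S.ray ξ).contracting.of_hausdorffEDist_ne_top hX (hβq.isClosed_range (by linarith) hβc)
      (range_nonempty _) hβd⟩, ?_, hβc, hβq, s, hs, by linarith⟩
  refine (toBoundary_eq_iff.2 ?_).trans (S.ray_mem ξ)
  rwa [Metric.hausdorffEDist_comm]

/-- A quasi-geodesic which shares a long initial segment with a quasi-geodesic representing a point
near `ζ` is itself close to the chosen ray of `ζ`. -/
theorem exists_dist_le_kappa_of_eqOn (ζ : Boundary o) {r : ℝ} (hr : 1 ≤ r) :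
    ∃ m₀ : ℝ, ∀ m : ℝ, m₀ ≤ m → ∀ ξ ∈ S.nbhd ζ m, ∀ q Q : ℝ, 1 ≤ q → q ≤ r → 0 ≤ Q → Q ≤ r →
      ∀ α β : ContractingRay o, β.toBoundary = ξ → Continuous α.toFun → Continuous β.toFun →
      IsQuasiGeodesicRay q Q α.toFun → IsQuasiGeodesicRay (2 * q + 4) Q β.toFun →
      ∀ s, (∀ t ≤ s, β.toFun t = α.toFun t) → m ≤ dist o (α.toFun s) →
      ∃ t s : ℝ≥0, r ≤ s ∧
        dist (α.toFun t) ((S.ray ζ).toFun s) ≤ kappa (S.gauge ζ) q Q := by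
  have hρ := S.sublinear_gauge ζ
  set κ := kappa (S.gauge ζ) (2 * r + 4) r + 1
  have hκ : 4 ≤ κ := by
    have := three_le_kappa (S.gauge ζ) (q := 2 * r + 4) (by linarith) r
    linarith
  set C := morseConst (2 * r + 4) r κ
  have hκC : κ ≤ C := le_morseConst (by linarith) (by linarith)
  refine ⟨r + κ + C + (8 * r ^ 2 * (κ + C + r) + r) + C, ?_⟩
  intro m hm ξ hξ q Q hq hqr hQ hQr α β hβ hαc hβc hαq hβq s hs hsm
  have hk1 : kappa (S.gauge ζ) q Q ≤ κ := by
    have := kappa_mono hρ hq (by linarith : q ≤ 2 * r + 4) hQr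
    linarith
  have hk0 := three_le_kappa (S.gauge ζ) hq Q
  have hk2 : kappa (S.gauge ζ) (2 * q + 4) Q ≤ kappa (S.gauge ζ) (2 * r + 4) r :=
    kappa_mono hρ (by linarith) (by linarith) hQr
  obtain ⟨T, R, hR, hd⟩ := S.exists_dist_lt_of_mem_nbhd hξ (by linarith) hQ hβ hβc hβq
  have hd' : dist (β.toFun T) ((S.ray ζ).toFun R) ≤ κ := by linarith
  obtain ⟨T', R', hR', hd''⟩ : ∃ T' R' : ℝ≥0, m - C ≤ R' ∧
      dist (α.toFun T') ((S.ray ζ).toFun R') ≤ C := by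
    -- If `β` meets the ray of `ζ` before the branching time, so does `α`. Otherwise the branch
    -- point itself is Morse-close to that ray and far out.
    rcases le_total T s with hTs | hTs
    · exact ⟨T, R, by linarith, by rw [← hs T hTs]; linarith⟩
    · have h1 := (infDist_le_morseConst hρ (S.ray ζ).map_zero (S.contracting_ray ζ)
        (by linarith) hQ hβq hβc β.map_zero (by linarith) hd' hTs).trans
        (morseConst_mono (by linarith) (by linarith) hQ hQr (by linarith) :
          morseConst (2 * q + 4) Q κ ≤ C)
      rw [hs s le_rfl] at h1
      obtain ⟨_, ⟨R', rfl⟩, hR'⟩ := exists_mem_proj (S.contracting_ray ζ).1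
        (range_nonempty _) (α.toFun s)
      refine ⟨s, R', ?_, hR'.trans_le h1⟩
      have h2 := dist_zero_isometry (S.isometry_ray ζ) (S.ray ζ).map_zero R'
      have h3 := dist_triangle_right o (α.toFun s) ((S.ray ζ).toFun R')
      have h4 := hR'.trans_le h1
      linarith
  refine exists_dist_le_kappa hρ (S.isometry_ray ζ) (S.ray ζ).map_zero (S.contracting_ray ζ)
    hq hQ hαq hαc α.map_zero hd'' ?_
  have h5 : 8 * q ^ 2 * (kappa (S.gauge ζ) q Q + C + Q) ≤ 8 * r ^ 2 * (κ + C + r) := by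
    have : 0 ≤ kappa (S.gauge ζ) q Q + C + Q := by linarith
    gcongr
  linarith

theorem metrizableSpace_topology (hX : IsGeodesicSpace X) :
    @TopologicalSpace.MetrizableSpace (Boundary o) S.topology := by
  choose F hF0 hF using fun (ζ : Boundary o) (n : ℕ) =>
    S.exists_diverted_ray hX ζ (m := n + 1) (by linarith [n.cast_nonneg (α := ℝ)])
  -- The partial sums make `f ζ` monotone while dominating every `F ζ n`; the term `n + 1` makes it
  -- unbounded.
  let f : Boundary o → ℕ → ℝ := fun ζ n => ∑ i ∈ Finset.range (n + 1), F ζ i + n + 1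
  have hsum0 : ∀ ζ n, 0 ≤ ∑ i ∈ Finset.range (n + 1), F ζ i := fun ζ n =>
    Finset.sum_nonneg fun i _ => (hF0 ζ i).le
  have hfn : ∀ (ζ) (n : ℕ), (n : ℝ) + 1 ≤ f ζ n := fun ζ n => by
    have := hsum0 ζ n
    simp only [f]
    linarith
  have hfF : ∀ ζ n, F ζ n ≤ f ζ n := fun ζ n => by
    have h1 := Finset.single_le_sum (fun i _ => (hF0 ζ i).le) (Finset.self_mem_range_succ n)
    have h2 := n.cast_nonneg (α := ℝ)
    simp only [f]
    linarith
  have hfm : ∀ ζ, Monotone (f ζ) := fun ζ => monotone_nat_of_le_succ fun n => by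
    simp only [f]
    rw [Finset.sum_range_succ _ (n + 1)]
    push_cast
    linarith [hF0 ζ (n + 1)]
  let _ : TopologicalSpace (Boundary o) := S.topology
  refine metrizableSpace_of_frink (fun ζ n => S.nbhd ζ (f ζ n))
    (fun ζ m n h => S.nbhd_anti ζ (hfm ζ h)) (fun ζ n => S.mem_nbhd_self ζ _) (fun s => ?_)
    (fun ζ n => ?_) (fun ζ η h => ?_)
  · refine forall₂_congr fun ζ _ => ⟨?_, ?_⟩
    · rintro ⟨r, -, h⟩
      obtain ⟨n, hn⟩ := exists_nat_ge r
      exact ⟨n, (S.nbhd_anti ζ (by linarith [hfn ζ n])).trans h⟩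
    · rintro ⟨n, h⟩
      exact ⟨_, by have := hfn ζ n; have := n.cast_nonneg (α := ℝ); linarith, h⟩
  · have hr : 1 ≤ f ζ n := by
      have := hfn ζ n
      have := n.cast_nonneg (α := ℝ)
      linarith
    obtain ⟨m₀, hm₀⟩ := S.exists_dist_le_kappa_of_eqOn ζ hr
    obtain ⟨m, hm⟩ := exists_nat_ge (max m₀ (f ζ n))
    refine ⟨m, ?_⟩
    rintro θ ⟨ξ, hξζ, hξθ⟩ η hη q Q hq hQ α hα hc hqg
    by_cases hle : q ≤ f ζ n ∧ Q ≤ f ζ n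
    · have hfm' : f ζ n ≤ m := (le_max_right _ _).trans hm
      -- The index `m` depends only on `ζ` and `n`. The contraction function of `θ` enters only
      -- through the radius `f θ m`, which guarantees a shared segment reaching radius `m + 1`.
      obtain ⟨β, hβ, hβc, hβq, s, hs, hsd⟩ := hF θ m η (S.nbhd_anti θ (hfF θ m) hη) ξ
        (S.nbhd_anti θ (hfF θ m) hξθ) q Q hq (by linarith [hle.1]) hQ (by linarith [hle.2]) α hα
        hc hqg
      obtain ⟨t, u, hu, hd⟩ := hm₀ m ((le_max_left _ _).trans hm) ξ
        (S.nbhd_anti ζ (by linarith [hfn ζ m]) hξζ) q Q hq hle.1 hQ hle.2 α β hβ hc hβc hqg hβq s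
        hs (by linarith)
      exact (setDist_le (mem_range_self t) (S.mem_image_inter_compl_ball hu)).trans hd
    -- For large `q` or `Q`, the terms `3q²` and `3Q` force `κ ≥ f ζ n`, which is the distance from
    -- `o` to the ray of `ζ` at parameter `f ζ n`.
    · have h1 : f ζ n ≤ kappa (S.gauge ζ) q Q := by
        have h2 := three_mul_le_kappa (S.gauge ζ) q Q
        have h3 := three_mul_sq_le_kappa (S.gauge ζ) q Q
        rw [not_and_or, not_le, not_le] at hle
        rcases hle with h | h
        · nlinarith
        · linarith
      have h0 : 0 ≤ f ζ n := by linarith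
      refine (setDist_le (mem_range_self 0)
        (S.mem_image_inter_compl_ball (Real.le_coe_toNNReal (f ζ n)))).trans ?_
      rw [α.map_zero, dist_zero_isometry (S.isometry_ray ζ) (S.ray ζ).map_zero,
        Real.coe_toNNReal _ h0]
      exact h1
  · refine S.eq_of_forall_mem_nbhd fun r => ?_
    obtain ⟨n, hn⟩ := exists_nat_ge r
    exact S.nbhd_anti ζ (by linarith [hfn ζ n]) (h n)

end RepSystem

end ContractingBoundary

/-- The contracting boundary of a proper geodesic metric space, with the Cashen–Mackay topology, is
metrizable. The topology is built from a choice of contracting geodesic representatives; such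
choices exist, and every one of them yields a metrizable topology. -/
theorem mainTheorem2 {X : Type*} [MetricSpace X] [ProperSpace X]
    (hX : ContractingBoundary.IsGeodesicSpace X) (o : X) :
    Nonempty (ContractingBoundary.RepSystem o) ∧
      ∀ S : ContractingBoundary.RepSystem o,
        @TopologicalSpace.MetrizableSpace (ContractingBoundary.Boundary o) S.topology := by
  exact ⟨ContractingBoundary.nonempty_repSystem hX o, fun S => S.metrizableSpace_topology hX⟩
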